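/- Let $m\ge 5$ and $e$ be positive integers with $1\le e\le m-1$, $e\notin\{m/3,2m/3\}$, $\gcd(m,e)=1$ and $m$ odd. Put $q=2^m$, let $\mathrm{Tr}$ be the trace from $\mathbb F_q$ to $\mathbb F_2$, and let $$\mathcal C=\mathcal C^{(e)}=\Big\{\big(\mathrm{Tr}(ax^{2^{2e}+1}+bx^{2^e+1}+cx)\big)_{x\in\mathbb F_q^*}: a,b,c\in\mathbb F_q\Big\}\subseteq\mathbb F_2^{\,q-1}.$$ Let $\widehat{\mathcal C}$ be the augmented code of $\mathcal C$ (generated by $\mathcal C$ and the all-one word), let $E=\overline{\widehat{\mathcal C}}$ be its extended code (each codeword $c$ of $\widehat{\mathcal C}$ gets one further coordinate $-\sum_i c_i$; the length is $q$), and let $E^\perp$ be the dual code of $E$. For a binary code $D$ of length $q$ let $\mathcal B_w(D)$ be the multiset of supports of the codewords of Hamming weight $w$ of $D$, and let $A_w(D)$ be the number of these codewords. A multiset of $k$-subsets (blocks) of a $v$-set is a $3$-$(v,k,\lambda)$ design if every $3$-subset of the $v$-set lies in exactly $\lambda$ blocks (an empty collection of blocks is a trivial design with $\lambda=0$); the design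 is simple if no block is repeated. Then: 1. $E$ and $E^\perp$ support $3$-designs, i.e. for every $0\le w\le q$ each of $\mathcal B_w(E)$ and $\mathcal B_w(E^\perp)$ is a $3$-$(q,w,\lambda)$ design for some $\lambda$ (depending on $w$ and on the code). 2. The minimum weight of $E$ is $k=2^{m-1}-2^{(m+1)/2}$, and $\mathcal B_k(E)$ is a simple $3$-$(q,k,\lambda)$ design with $$\lambda=\frac{(2^{m-1}-1)\,k\,(k-1)(k-2)}{24\,(2^m-2)}.$$ 3. The minimum weight of $E^\perp$ is $8$, and $\mathcal B_8(E^\perp)$ is a simple $3$-$(q,8,\lambda)$ design with $$\lambda=\frac{336\,A_8(E^\perp)}{q(q-1)(q-2)},\qquad A_8(E^\perp)=\frac1{315}\cdot 2^{m-7}(2^m-1)\big(-272+39\cdot 2^{m+2}-3\cdot 4^{m+1}+8^m\big).$$ -/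

import Mathlib

/-! Binary linear codes with coordinate set `ι` are `ZMod 2`-subspaces of `ι → ZMod 2`. -/

section Designs

open Classical in
/-- A multiset `B` of blocks on the point set `P` is a `t`-`(v, k, lam)` design: `P` has `v` points,
every block has `k` points, and every `t`-subset of `P` lies in exactly `lam` blocks, counted with
multiplicity. No relation between `t` and `k` is imposed here, so that an empty block set is a
(trivial) `t`-`(v, k, 0)` design for all `t` and `k`. -/
def IsDesign {P : Type*} [Fintype P] (t v k lam : ℕ) (B : Multiset (Finset P)) : Prop :=
  Fintype.card P = v ∧ (∀ b ∈ B, b.card = k) ∧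
    ∀ T : Finset P, T.card = t → B.countP (fun b => T ⊆ b) = lam

/-- A simple `t`-`(v, k, lam)` design, `1 ≤ t ≤ k ≤ v`: no block is repeated. -/
def IsSimpleDesign {P : Type*} [Fintype P] (t v k lam : ℕ) (B : Multiset (Finset P)) : Prop :=
  1 ≤ t ∧ t ≤ k ∧ k ≤ v ∧ IsDesign t v k lam B ∧ B.Nodup

end Designs

section Codes

/-- The support of a word. -/
def wordSupport {ι : Type*} [Fintype ι] (c : ι → ZMod 2) : Finset ι :=
  Finset.univ.filter fun i => c i ≠ 0

open Classical in
/-- The finite set of codewords of Hamming weight `w`. -/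
noncomputable def codewordsOfWeight {ι : Type*} [Fintype ι] (C : Submodule (ZMod 2) (ι → ZMod 2))
    (w : ℕ) : Finset (ι → ZMod 2) :=
  Finset.univ.filter fun c => c ∈ C ∧ hammingNorm c = w

/-- The number `A_w(C)` of codewords of Hamming weight `w`. -/
noncomputable def weightCount {ι : Type*} [Fintype ι] (C : Submodule (ZMod 2) (ι → ZMod 2))
    (w : ℕ) : ℕ :=
  (codewordsOfWeight C w).card

/-- The multiset `B_w(C)` of the supports of the codewords of weight `w`. -/
noncomputable def supportBlocks {ι : Type*} [Fintype ι] (C : Submodule (ZMod 2) (ι → ZMod 2))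
    (w : ℕ) : Multiset (Finset ι) :=
  (codewordsOfWeight C w).val.map wordSupport

/-- `C` supports `t`-designs: for every `0 ≤ w ≤ v`, `v` the length, the supports of the codewords
of weight `w` form a `t`-design. -/
def SupportsDesigns {ι : Type*} [Fintype ι] (C : Submodule (ZMod 2) (ι → ZMod 2)) (t : ℕ) : Prop :=
  ∀ w ≤ Fintype.card ι, ∃ lam : ℕ, IsDesign t (Fintype.card ι) w lam (supportBlocks C w)

/-- `w` is the minimum weight (minimum distance) of `C`. -/
def IsMinWeight {ι : Type*} [Fintype ι] (C : Submodule (ZMod 2) (ι → ZMod 2)) (w : ℕ) : Prop :=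
  IsLeast {n : ℕ | ∃ c ∈ C, c ≠ 0 ∧ hammingNorm c = n} w

/-- The dual code. -/
def dualCode {ι : Type*} [Fintype ι] (C : Submodule (ZMod 2) (ι → ZMod 2)) :
    Submodule (ZMod 2) (ι → ZMod 2) where
  carrier := {y | ∀ c ∈ C, ∑ i, c i * y i = 0}
  add_mem' := by
    intro y z hy hz c hc
    simp [mul_add, Finset.sum_add_distrib, hy c hc, hz c hc]
  zero_mem' := by
    intro c _
    simp
  smul_mem' := by
    intro r y hy c hc
    have h : ∀ i, c i * (r • y) i = r * (c i * y i) := fun i => by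
      simp only [Pi.smul_apply, smul_eq_mul]
      ring
    rw [Finset.sum_congr rfl fun i _ => h i, ← Finset.mul_sum, hy c hc, mul_zero]

/-- The augmented code: the all-one word is adjoined to the generators. -/
def augmentedCode {ι : Type*} (C : Submodule (ZMod 2) (ι → ZMod 2)) :
    Submodule (ZMod 2) (ι → ZMod 2) :=
  C ⊔ Submodule.span (ZMod 2) {fun _ => 1}

/-- The word `c` with the overall parity check `-∑ c i` appended at the new coordinate `none`. -/
def extendWord {ι : Type*} [Fintype ι] : (ι → ZMod 2) →ₗ[ZMod 2] (Option ι → ZMod 2) where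
  toFun c := fun o => o.elim (-∑ i, c i) c
  map_add' c d := by
    funext o
    cases o with
    | none => simp [Finset.sum_add_distrib, add_comm]
    | some i => simp
  map_smul' r c := by
    funext o
    cases o with
    | none => simp [Finset.mul_sum]
    | some i => simp

/-- The extended code. -/
def extendedCode {ι : Type*} [Fintype ι] (C : Submodule (ZMod 2) (ι → ZMod 2)) :
    Submodule (ZMod 2) (Option ι → ZMod 2) :=
  C.map extendWord

/-- The code of all words `(Tr(a x^(2^(2e)+1) + b x^(2^e+1) + c x))`, `x` running over the nonzero
elements of the finite field `F` of characteristic two, with `a, b, c ∈ F`. -/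
noncomputable def codeC (F : Type*) [Field F] [Algebra (ZMod 2) F] (e : ℕ) :
    Submodule (ZMod 2) (Fˣ → ZMod 2) where
  carrier := {w | ∃ a b c : F, w = fun x : Fˣ =>
    Algebra.trace (ZMod 2) F
      (a * (x : F) ^ (2 ^ (2 * e) + 1) + b * (x : F) ^ (2 ^ e + 1) + c * (x : F))}
  add_mem' := by
    rintro _ _ ⟨a, b, c, rfl⟩ ⟨a', b', c', rfl⟩
    refine ⟨a + a', b + b', c + c', ?_⟩
    funext x
    simp only [Pi.add_apply, ← map_add]
    congr 1
    ring
  zero_mem' := ⟨0, 0, 0, by funext x; simp⟩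
  smul_mem' := by
    rintro r _ ⟨a, b, c, rfl⟩
    refine ⟨r • a, r • b, r • c, ?_⟩
    funext x
    simp only [Pi.smul_apply, ← map_smul, smul_add, smul_mul_assoc]

/-- The extended code of the augmented code of `codeC F e`. -/
noncomputable def codeE (F : Type*) [Field F] [Fintype F] [DecidableEq F] [Algebra (ZMod 2) F]
    (e : ℕ) : Submodule (ZMod 2) (Option Fˣ → ZMod 2) :=
  extendedCode (augmentedCode (codeC F e))

end Codes

/-! The coordinates of $E$ are the points of $F$ (the parity coordinate is the value at $0$), and
its words are $x\mapsto Q(x)+h$ with $Q(x)=\mathrm{Tr}(a\,x\sigma^2(x)+b\,x\sigma(x)+c\,x)$, where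
$\sigma(x)=x^{2^e}$ has only $0$ and $1$ as fixed points because $\gcd(m,e)=1$.

Weights of $E$: the square of $S=\sum_x(-1)^{Q(x)}$ is $0$ or $q\cdot|\mathrm{rad}|$. The radical is
the zero set of a polynomial of degree at most $4$ in $\sigma$, so it has at most $2^4$ elements
(`card_zeros_skew_le`); since $m$ is odd and $S^2$ is a square, $|\mathrm{rad}|\in\{2,8\}$ when
$S\ne0$. With $q=2s^2$ this leaves $S\in\{0,\pm2s,\pm4s\}$, hence five weights besides $0$ and $q$
(`hammingNorm_mem_of_mem_codeE`).

Weights of $E^\perp$: the all-one word excludes odd weights, and the almost perfect nonlinearity of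
$x\sigma(x)$ excludes weights $2$ and $4$. The 2nd and 4th power moments then fix the weight
distribution of $E$, the 6th forces $A_6(E^\perp)=0$ and the 8th yields $A_8(E^\perp)$
(`moments_codeE`). So the dual distance is $8$.

Designs: $5$ weights and $t=3$ satisfy $5+3\le8$, so the Assmus–Mattson argument
(`sum_words_comp_perm`) gives 3-designs from $E$ and from $E^\perp$. The values of $\lambda$ follow
by double counting (`IsDesign.mul_choose`). -/

/-! ### Characters of binary words and functions of low degree. -/

section Characters

variable {ι : Type*} [Fintype ι]

/-- The nontrivial character of `ZMod 2`. -/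
def sgn (z : ZMod 2) : ℤ := if z = 0 then 1 else -1

@[simp] lemma sgn_zero : sgn 0 = 1 := rfl

lemma sgn_add (x y : ZMod 2) : sgn (x + y) = sgn x * sgn y := by
  revert x y; decide

lemma sgn_mul_self (x : ZMod 2) : sgn x * sgn x = 1 := by
  revert x; decide

lemma zmod_two_eq_one {z : ZMod 2} (h : z ≠ 0) : z = 1 := by
  revert z; decide

open Classical in
/-- The finite set of codewords. -/
noncomputable def words (C : Submodule (ZMod 2) (ι → ZMod 2)) : Finset (ι → ZMod 2) :=
  Finset.univ.filter (· ∈ C)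

@[simp] lemma mem_words {C : Submodule (ZMod 2) (ι → ZMod 2)} {c : ι → ZMod 2} :
    c ∈ words C ↔ c ∈ C := by
  simp [words]

lemma words_card_pos (C : Submodule (ZMod 2) (ι → ZMod 2)) : 0 < (words C).card :=
  Finset.card_pos.2 ⟨0, by simp⟩

lemma mem_codewordsOfWeight {C : Submodule (ZMod 2) (ι → ZMod 2)} {w : ℕ} {c : ι → ZMod 2} :
    c ∈ codewordsOfWeight C w ↔ c ∈ C ∧ hammingNorm c = w := by
  simp [codewordsOfWeight]

@[simp] lemma mem_wordSupport {c : ι → ZMod 2} {i : ι} : i ∈ wordSupport c ↔ c i ≠ 0 := by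
  simp [wordSupport]

lemma card_wordSupport (c : ι → ZMod 2) : (wordSupport c).card = hammingNorm c := rfl

lemma wordSupport_injective : Function.Injective (wordSupport : (ι → ZMod 2) → Finset ι) := by
  intro c d h
  funext i
  have hi : c i ≠ 0 ↔ d i ≠ 0 := by
    rw [← mem_wordSupport, h, mem_wordSupport]
  by_cases hc : c i = 0
  · rw [hc, eq_comm]
    by_contra hd
    exact hi.2 hd hc
  · rw [zmod_two_eq_one hc, zmod_two_eq_one (hi.1 hc)]

lemma hammingNorm_comp_perm (c : ι → ZMod 2) (σ : Equiv.Perm ι) :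
    hammingNorm (c ∘ σ) = hammingNorm c := by
  classical
  refine Finset.card_bij (fun i _ => σ i) ?_ ?_ ?_
  · intro i hi
    simpa using hi
  · intro i _ j _ h
    exact σ.injective h
  · intro j hj
    exact ⟨σ.symm j, by simpa using hj, by simp⟩

lemma hammingNorm_add_le (c d : ι → ZMod 2) :
    hammingNorm (c + d) ≤ hammingNorm c + hammingNorm d := by
  classical
  rw [← card_wordSupport, ← card_wordSupport, ← card_wordSupport]
  refine (Finset.card_le_card ?_).trans (Finset.card_union_le _ _)
  intro i hi
  simp only [Finset.mem_union, mem_wordSupport, Pi.add_apply] at hi ⊢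
  by_contra! h
  exact hi (by rw [h.1, h.2, add_zero])

lemma mem_dualCode {C : Submodule (ZMod 2) (ι → ZMod 2)} {y : ι → ZMod 2} :
    y ∈ dualCode C ↔ ∀ c ∈ C, c ⬝ᵥ y = 0 := Iff.rfl

open Classical in
/-- Orthogonality of characters on a binary code. -/
lemma sum_words_sgn (C : Submodule (ZMod 2) (ι → ZMod 2)) (y : ι → ZMod 2) :
    ∑ c ∈ words C, sgn (c ⬝ᵥ y) = if y ∈ dualCode C then ((words C).card : ℤ) else 0 := by
  split_ifs with h
  · rw [Finset.sum_congr rfl fun c hc => by rw [mem_dualCode.1 h c (mem_words.1 hc), sgn_zero]]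
    simp
  · rw [mem_dualCode] at h
    push Not at h
    obtain ⟨d, hd, hdy⟩ := h
    have hs : ∑ c ∈ words C, sgn (c ⬝ᵥ y) = ∑ c ∈ words C, sgn ((c + d) ⬝ᵥ y) := by
      refine (Finset.sum_bij' (fun c _ => c + d) (fun c _ => c - d) ?_ ?_ ?_ ?_ ?_).symm
      · intro c hc
        exact mem_words.2 (C.add_mem (mem_words.1 hc) hd)
      · intro c hc
        exact mem_words.2 (C.sub_mem (mem_words.1 hc) hd)
      · simp
      · simp
      · simp
    have hneg : ∑ c ∈ words C, sgn ((c + d) ⬝ᵥ y) = -∑ c ∈ words C, sgn (c ⬝ᵥ y) := by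
      rw [← Finset.sum_neg_distrib]
      refine Finset.sum_congr rfl fun c _ => ?_
      rw [add_dotProduct, sgn_add, zmod_two_eq_one hdy]
      simp [sgn]
    omega

/-- The character of the group of words attached to a word. -/
def chr (y : ι → ZMod 2) : (ι → ZMod 2) → ℚ := fun c => (sgn (c ⬝ᵥ y) : ℚ)

lemma chr_mul (y z : ι → ZMod 2) : chr y * chr z = chr (y + z) := by
  funext c
  simp [chr, dotProduct_add, sgn_add]

/-- Functions on words of degree at most `n`: combinations of characters of words of weight at
most `n`. -/
def lowDegree (ι : Type*) [Fintype ι] (n : ℕ) : Submodule ℚ ((ι → ZMod 2) → ℚ) :=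
  Submodule.span ℚ (chr '' {y | hammingNorm y ≤ n})

lemma lowDegree_mono {m n : ℕ} (h : m ≤ n) : lowDegree ι m ≤ lowDegree ι n :=
  Submodule.span_mono (Set.image_mono fun _ hy => le_trans hy h)

lemma chr_mem_lowDegree {y : ι → ZMod 2} {n : ℕ} (h : hammingNorm y ≤ n) :
    chr y ∈ lowDegree ι n :=
  Submodule.subset_span ⟨y, h, rfl⟩

lemma one_mem_lowDegree (n : ℕ) : (1 : (ι → ZMod 2) → ℚ) ∈ lowDegree ι n := by
  have h : (1 : (ι → ZMod 2) → ℚ) = chr 0 := by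
    funext c
    simp [chr]
  rw [h]
  exact chr_mem_lowDegree (by simp)

/-- A product of characters is the character of the sum of the words, and weight is subadditive. -/
lemma mul_mem_lowDegree {f g : (ι → ZMod 2) → ℚ} {m n : ℕ} (hf : f ∈ lowDegree ι m)
    (hg : g ∈ lowDegree ι n) : f * g ∈ lowDegree ι (m + n) := by
  have h : lowDegree ι m * lowDegree ι n ≤ lowDegree ι (m + n) := by
    rw [lowDegree, lowDegree, Submodule.span_mul_span, Submodule.span_le]
    rintro _ ⟨_, ⟨y, hy, rfl⟩, _, ⟨z, hz, rfl⟩, rfl⟩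
    simp only [chr_mul]
    exact chr_mem_lowDegree ((hammingNorm_add_le y z).trans (add_le_add hy hz))
  exact h (Submodule.mul_mem_mul hf hg)

lemma pow_mem_lowDegree {f : (ι → ZMod 2) → ℚ} (hf : f ∈ lowDegree ι 1) (n : ℕ) :
    f ^ n ∈ lowDegree ι n := by
  induction n with
  | zero => simpa using one_mem_lowDegree 0
  | succ n ih => exact pow_succ f n ▸ mul_mem_lowDegree ih hf

lemma eval_mem_lowDegree {f : (ι → ZMod 2) → ℚ} (hf : f ∈ lowDegree ι 1)
    (p : Polynomial ℚ) {n : ℕ} (hn : p.natDegree ≤ n) : (fun c => p.eval (f c)) ∈ lowDegree ι n := by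
  have h : (fun c => p.eval (f c)) = ∑ i ∈ Finset.range (p.natDegree + 1), p.coeff i • f ^ i := by
    funext c
    simp [Polynomial.eval_eq_sum_range]
  rw [h]
  refine Submodule.sum_mem _ fun i hi => Submodule.smul_mem _ _ ?_
  exact lowDegree_mono (by simp at hi; omega) (pow_mem_lowDegree hf i)

/-- The indicator of `c i ≠ 0` is $(1-\chi_{e_i})/2$. Both the weight (take `T` to be everything)
and the weight inside `T` are thus of degree one. -/
lemma card_support_filter_mem_lowDegree (T : Finset ι) :
    (fun c : ι → ZMod 2 => ((T.filter fun i => c i ≠ 0).card : ℚ)) ∈ lowDegree ι 1 := by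
  classical
  have h : (fun c : ι → ZMod 2 => ((T.filter fun i => c i ≠ 0).card : ℚ)) =
      ∑ i ∈ T, ((1 / 2 : ℚ) • (1 : (ι → ZMod 2) → ℚ) - (1 / 2 : ℚ) • chr (Pi.single i 1)) := by
    funext c
    simp only [Finset.card_filter, Nat.cast_sum, Finset.sum_apply]
    refine Finset.sum_congr rfl fun i _ => ?_
    by_cases hc : c i = 0 <;> simp [chr, sgn, hc] <;> norm_num
  rw [h]
  refine Submodule.sum_mem _ fun i _ => Submodule.sub_mem _
    (Submodule.smul_mem _ _ (one_mem_lowDegree 1)) (Submodule.smul_mem _ _ (chr_mem_lowDegree ?_))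
  rw [← card_wordSupport]
  refine (Finset.card_le_card (t := {i}) fun j hj => ?_).trans (by simp)
  rw [mem_wordSupport] at hj
  by_contra hji
  exact hj (by simp at hji; simp [hji])

/-- A code of dual distance at least `d` cannot distinguish coordinates by functions of degree
less than `d`. -/
lemma sum_words_comp_perm_of_mem_lowDegree (C : Submodule (ZMod 2) (ι → ZMod 2)) {d n : ℕ}
    (hd : ∀ y ∈ dualCode C, y ≠ 0 → d ≤ hammingNorm y) (hn : n < d) {φ : (ι → ZMod 2) → ℚ}
    (hφ : φ ∈ lowDegree ι n) (π : Equiv.Perm ι) :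
    ∑ c ∈ words C, φ (c ∘ π) = ∑ c ∈ words C, φ c := by
  classical
  induction hφ using Submodule.span_induction with
  | mem f hf =>
    obtain ⟨y, hy, rfl⟩ := hf
    -- Below weight `d` the dual code contains only zero, so a character of such weight sums to
    -- $|C|$ or $0$ according to whether its word is zero, which no permutation changes.
    have hdual : ∀ z : ι → ZMod 2, hammingNorm z ≤ n → (z ∈ dualCode C ↔ z = 0) := by
      intro z hz
      refine ⟨fun h => ?_, fun h => h ▸ Submodule.zero_mem _⟩
      by_contra h0
      exact absurd (hd z h h0) (by omega)
    have hy' : hammingNorm (y ∘ π.symm) ≤ n := (hammingNorm_comp_perm y π.symm).trans_le hy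
    have hcomp : ∀ c : ι → ZMod 2, chr y (c ∘ π) = chr (y ∘ π.symm) c := by
      intro c
      simp only [chr, dotProduct]
      congr 2
      exact Fintype.sum_equiv π _ _ (by simp)
    have h0 : y ∘ π.symm = 0 ↔ y = 0 := by
      rw [← hammingNorm_eq_zero, hammingNorm_comp_perm, hammingNorm_eq_zero]
    simp only [hcomp]
    simp only [chr]
    rw [← Int.cast_sum, ← Int.cast_sum, sum_words_sgn, sum_words_sgn]
    simp only [hdual y hy, hdual _ hy', h0]
  | zero => simp
  | add f g _ _ hf hg => simp [Finset.sum_add_distrib, hf, hg]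
  | smul a f _ hf => simp [← Finset.mul_sum, hf]

end Characters

/-! ### Permutations of coordinates with prescribed effect. -/

section Permutations

lemma exists_perm_comp_eq {ι κ : Type*} [Fintype ι] [DecidableEq κ] (f g : ι → κ)
    (h : ∀ k, (Finset.univ.filter fun i => f i = k).card =
      (Finset.univ.filter fun i => g i = k).card) :
    ∃ σ : Equiv.Perm ι, g ∘ σ = f := by
  have e : ∀ k, Nonempty ({i // f i = k} ≃ {i // g i = k}) := fun k =>
    ⟨Fintype.equivOfCardEq (by rw [Fintype.card_subtype, Fintype.card_subtype, h k])⟩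
  exact ⟨Equiv.ofFiberEquiv fun k => (e k).some, funext fun i => Equiv.ofFiberEquiv_map _ i⟩

lemma exists_perm_map_eq {ι : Type*} [Fintype ι] (S T : Finset ι)
    (h : S.card = T.card) : ∃ σ : Equiv.Perm ι, ∀ i, σ i ∈ T ↔ i ∈ S := by
  classical
  obtain ⟨σ, hσ⟩ := exists_perm_comp_eq (fun i => decide (i ∈ S)) (fun i => decide (i ∈ T)) (by
    rintro (_ | _)
    · simp only [decide_eq_false_iff_not, ← Finset.compl_filter, Finset.card_compl,
        Finset.filter_univ_mem, h]
    · simpa using h)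
  exact ⟨σ, fun i => by simpa using congrFun hσ i⟩

/-- The weight and the weight inside `T` form a complete invariant of the orbits of words under the
stabilizer of `T`: together they fix the sizes of the four classes given by the letter and by
membership in `T`. -/
lemma exists_perm_comp_eq_of_card_eq {ι : Type*} [Fintype ι] (T : Finset ι) (c d : ι → ZMod 2)
    (h : hammingNorm c = hammingNorm d)
    (hT : (T.filter fun i => c i ≠ 0).card = (T.filter fun i => d i ≠ 0).card) :
    ∃ σ : Equiv.Perm ι, (∀ i, σ i ∈ T ↔ i ∈ T) ∧ d ∘ σ = c := by
  classical
  have key : ∀ c : ι → ZMod 2,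
      (T.filter fun i => c i ≠ 0).card +
        (Finset.univ.filter fun i => (c i, decide (i ∈ T)) = ((1 : ZMod 2), false)).card =
          hammingNorm c ∧
      (T.filter fun i => c i ≠ 0).card =
        (Finset.univ.filter fun i => (c i, decide (i ∈ T)) = ((1 : ZMod 2), true)).card ∧
      (T.filter fun i => c i ≠ 0).card +
        (Finset.univ.filter fun i => (c i, decide (i ∈ T)) = ((0 : ZMod 2), true)).card =
          T.card ∧
      (Finset.univ.filter fun i => (c i, decide (i ∈ T)) = ((0 : ZMod 2), true)).card +
        (Finset.univ.filter fun i => (c i, decide (i ∈ T)) = ((0 : ZMod 2), false)).card +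
          hammingNorm c = Fintype.card ι := by
    intro c
    have h1 : ∀ i, c i = 1 ↔ c i ≠ 0 := fun i =>
      ⟨fun h => by rw [h]; exact one_ne_zero, zmod_two_eq_one⟩
    simp only [Prod.mk.injEq, decide_eq_true_eq, decide_eq_false_iff_not, h1]
    refine ⟨?_, ?_, ?_, ?_⟩
    · rw [← card_wordSupport,
        ← Finset.card_filter_add_card_filter_not (s := wordSupport c) (· ∈ T)]
      congr 2 <;> ext i <;> simp [and_comm]
    · congr 1
      ext i
      simp [and_comm]
    · rw [← Finset.card_filter_add_card_filter_not (s := T) (fun i => c i ≠ 0)]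
      congr 2
      ext i
      simp [and_comm]
    · rw [← Finset.card_univ,
        ← Finset.card_filter_add_card_filter_not (s := Finset.univ) (fun i => c i = 0),
        ← Finset.card_filter_add_card_filter_not (s := Finset.univ.filter fun i => c i = 0) (· ∈ T)]
      simp only [Finset.filter_filter]
      rfl
  obtain ⟨σ, hσ⟩ := exists_perm_comp_eq (fun i => (c i, decide (i ∈ T)))
    (fun i => (d i, decide (i ∈ T))) (by
      rintro ⟨z, b⟩
      have hc := key c
      have hd := key d
      obtain rfl | rfl : z = 0 ∨ z = 1 := by revert z; decide
      all_goals cases b <;> omega)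
  refine ⟨σ, fun i => ?_, funext fun i => ?_⟩
  · simpa using congrArg Prod.snd (congrFun hσ i)
  · exact congrArg Prod.fst (congrFun hσ i)

end Permutations

/-! ### The Assmus–Mattson theorem for a code and for its dual. -/

section AssmusMattson

variable {ι : Type*} [Fintype ι]

/-- The core of the Assmus–Mattson theorem: a function of words that is invariant under the
permutations stabilizing a set `T` of coordinates has the same sum over the code after any
permutation of the coordinates. -/
theorem sum_words_comp_perm (C : Submodule (ZMod 2) (ι → ZMod 2)) {d : ℕ}
    (hd : ∀ y ∈ dualCode C, y ≠ 0 → d ≤ hammingNorm y) (V : Finset ℕ) (T : Finset ι)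
    (hVT : V.card + T.card ≤ d)
    (hV : ∀ c ∈ C, c = 0 ∨ c = (fun _ => 1) ∨ hammingNorm c ∈ V) (Φ : (ι → ZMod 2) → ℚ)
    (hΦ : ∀ σ : Equiv.Perm ι, (∀ i, σ i ∈ T ↔ i ∈ T) → ∀ c, Φ (c ∘ σ) = Φ c)
    (π : Equiv.Perm ι) :
    ∑ c ∈ words C, Φ (c ∘ π) = ∑ c ∈ words C, Φ c := by
  classical
  set n : (ι → ZMod 2) → ℕ := fun c => (T.filter fun i => c i ≠ 0).card with hn
  -- By invariance under the stabilizer of `T`, `Φ` depends only on the weight and on the weight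
  -- inside `T`.
  obtain ⟨G, hG⟩ : ∃ G : ℕ → ℕ → ℚ, ∀ c, Φ c = G (hammingNorm c) (n c) := by
    have hfac : Function.FactorsThrough Φ (fun c => (hammingNorm c, n c)) := by
      intro c c' h
      obtain ⟨σ, hσT, rfl⟩ := exists_perm_comp_eq_of_card_eq T c c' (congrArg Prod.fst h)
        (congrArg Prod.snd h)
      exact hΦ σ hσT c'
    refine ⟨fun a b => Function.extend (fun c => (hammingNorm c, n c)) Φ 0 (a, b), fun c => ?_⟩
    exact (hfac.extend_apply _ c).symm
  have hcast : ∀ s : Finset ℕ, Set.InjOn (fun v : ℕ => (v : ℚ)) s := fun s a _ b _ h =>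
    Nat.cast_injective h
  set W := Finset.range (T.card + 1) with hW
  have hnW : ∀ c, n c ∈ W := fun c => by
    simp only [hW, hn, Finset.mem_range]
    exact Nat.lt_succ_of_le (Finset.card_filter_le _ _)
  set p : ℕ → Polynomial ℚ := fun v => Lagrange.basis V (fun v : ℕ => (v : ℚ)) v
  set r : ℕ → Polynomial ℚ := fun u => Lagrange.basis W (fun v : ℕ => (v : ℚ)) u
  -- Lagrange interpolation in both variables gives degree at most $(|V|-1)+|T|<d$. `Ψ` agrees with
  -- `Φ` on words with weight in `V`; the exceptional words $0$ and $1$ are fixed by every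
  -- permutation, so the error there is harmless.
  set Ψ : (ι → ZMod 2) → ℚ := fun c =>
    ∑ v ∈ V, ∑ u ∈ W, G v u * ((p v).eval (hammingNorm c : ℚ) * (r u).eval (n c : ℚ)) with hΨ
  have hΨΦ : ∀ c, hammingNorm c ∈ V → Ψ c = Φ c := by
    intro c hc
    simp only [hΨ]
    rw [Finset.sum_eq_single_of_mem _ hc, Finset.sum_eq_single_of_mem _ (hnW c), hG]
    · simp only [p, r]
      rw [Lagrange.eval_basis_self (hcast _) hc, Lagrange.eval_basis_self (hcast _) (hnW c)]
      simp
    · intro u _ hu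
      simp only [r]
      rw [Lagrange.eval_basis_of_ne hu (hnW c)]
      simp
    · intro v _ hv
      refine Finset.sum_eq_zero fun u _ => ?_
      simp only [p]
      rw [Lagrange.eval_basis_of_ne hv hc]
      simp
  have hΨsum : ∑ c ∈ words C, Ψ (c ∘ π) = ∑ c ∈ words C, Ψ c := by
    rcases V.eq_empty_or_nonempty with rfl | hne
    · simp [hΨ]
    · refine sum_words_comp_perm_of_mem_lowDegree C hd
        (n := (V.card - 1) + T.card) (by have := hne.card_pos; omega) ?_ π
      have : Ψ = ∑ v ∈ V, ∑ u ∈ W, G v u •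
          ((fun c : ι → ZMod 2 => (p v).eval (hammingNorm c : ℚ)) *
            fun c => (r u).eval (n c : ℚ)) := by
        funext c
        simp [hΨ]
      rw [this]
      refine Submodule.sum_mem _ fun v hv => Submodule.sum_mem _ fun u hu =>
        Submodule.smul_mem _ _ (mul_mem_lowDegree ?_ ?_)
      · exact eval_mem_lowDegree (card_support_filter_mem_lowDegree Finset.univ) _
          (Lagrange.natDegree_basis (hcast _) hv).le
      · refine eval_mem_lowDegree (card_support_filter_mem_lowDegree T) _ ?_
        rw [Lagrange.natDegree_basis (hcast _) hu]
        simp [hW]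
  have hdiff : ∑ c ∈ words C, (Φ (c ∘ π) - Ψ (c ∘ π)) = ∑ c ∈ words C, (Φ c - Ψ c) := by
    refine Finset.sum_congr rfl fun c hc => ?_
    rcases hV c (mem_words.1 hc) with rfl | rfl | h
    · rfl
    · rfl
    · rw [hΨΦ c h, hΨΦ _ (by rwa [hammingNorm_comp_perm]), sub_self, sub_self]
  simp only [Finset.sum_sub_distrib] at hdiff
  linarith

lemma subset_wordSupport_comp {S T : Finset ι} {π : Equiv.Perm ι} (hπ : ∀ i, π i ∈ T ↔ i ∈ S)
    (c : ι → ZMod 2) : S ⊆ wordSupport (c ∘ π) ↔ T ⊆ wordSupport c := by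
  simp only [Finset.subset_iff, ← hπ, mem_wordSupport, Function.comp_apply]
  exact π.forall_congr_right (q := fun i => i ∈ T → c i ≠ 0)

open Classical in
lemma countP_supportBlocks (C : Submodule (ZMod 2) (ι → ZMod 2)) (w : ℕ) (T : Finset ι) :
    (supportBlocks C w).countP (fun b => T ⊆ b) =
      ((codewordsOfWeight C w).filter fun c => T ⊆ wordSupport c).card := by
  rw [supportBlocks, Multiset.countP_map]
  rfl

-- Permutations act transitively on `t`-sets, so invariance of the count under them is enough. If
-- there is no `t`-set, the condition is vacuous and $\lambda=0$ serves.
open Classical in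
lemma supportsDesigns_of_card_eq (C : Submodule (ZMod 2) (ι → ZMod 2)) (t : ℕ)
    (h : ∀ (w : ℕ) (T : Finset ι), T.card = t → ∀ π : Equiv.Perm ι,
      ((codewordsOfWeight C w).filter fun c => T ⊆ wordSupport (c ∘ π)).card =
        ((codewordsOfWeight C w).filter fun c => T ⊆ wordSupport c).card) :
    SupportsDesigns C t := by
  intro w _
  have hblock : ∀ b ∈ supportBlocks C w, b.card = w := by
    intro b hb
    rw [supportBlocks, Multiset.mem_map] at hb
    obtain ⟨c, hc, rfl⟩ := hb
    exact (mem_codewordsOfWeight.1 hc).2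
  by_cases hT : ∃ S : Finset ι, S.card = t
  · obtain ⟨S, hS⟩ := hT
    refine ⟨((codewordsOfWeight C w).filter fun c => S ⊆ wordSupport c).card, rfl, hblock,
      fun T hTc => ?_⟩
    obtain ⟨π, hπ⟩ := exists_perm_map_eq S T (hS.trans hTc.symm)
    rw [← h w S hS π]
    simp only [subset_wordSupport_comp hπ]
    exact countP_supportBlocks C w T
  · exact ⟨0, rfl, hblock, fun T hTc => absurd ⟨T, hTc⟩ hT⟩

/-- The Assmus–Mattson theorem for a binary code. -/
theorem supportsDesigns_of_dual_distance (C : Submodule (ZMod 2) (ι → ZMod 2)) {d t : ℕ}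
    (hd : ∀ y ∈ dualCode C, y ≠ 0 → d ≤ hammingNorm y) (V : Finset ℕ) (hVt : V.card + t ≤ d)
    (hV : ∀ c ∈ C, c = 0 ∨ c = (fun _ => 1) ∨ hammingNorm c ∈ V) :
    SupportsDesigns C t := by
  classical
  refine supportsDesigns_of_card_eq C t fun w T hT π => ?_
  have := sum_words_comp_perm C hd V T (hT ▸ hVt) hV
    (fun c => if hammingNorm c = w ∧ T ⊆ wordSupport c then 1 else 0) (by
      intro σ hσ c
      simp only [hammingNorm_comp_perm]
      simp only [subset_wordSupport_comp hσ]) π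
  simp only [hammingNorm_comp_perm, Finset.sum_boole, Nat.cast_inj] at this
  simpa [codewordsOfWeight, words, Finset.filter_filter, and_assoc] using this

/-- The Assmus–Mattson theorem for the dual of a binary code. -/
theorem supportsDesigns_dualCode_of_dual_distance (C : Submodule (ZMod 2) (ι → ZMod 2)) {d t : ℕ}
    (hd : ∀ y ∈ dualCode C, y ≠ 0 → d ≤ hammingNorm y) (V : Finset ℕ) (hVt : V.card + t ≤ d)
    (hV : ∀ c ∈ C, c = 0 ∨ c = (fun _ => 1) ∨ hammingNorm c ∈ V) :
    SupportsDesigns (dualCode C) t := by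
  classical
  refine supportsDesigns_of_card_eq (dualCode C) t fun w T hT π => ?_
  -- The character transform of the indicator of words of weight `w` covering `T`. By orthogonality
  -- its sum over `C` is $|C|$ times the number of such words in the dual, so the core theorem for
  -- `C` itself also settles the dual.
  set Φ : (ι → ZMod 2) → ℚ := fun c =>
    ∑ y : ι → ZMod 2, if hammingNorm y = w ∧ T ⊆ wordSupport y then (sgn (c ⬝ᵥ y) : ℚ) else 0
    with hΦ
  have hdot : ∀ (σ : Equiv.Perm ι) (c y : ι → ZMod 2), (c ∘ σ) ⬝ᵥ (y ∘ σ) = c ⬝ᵥ y :=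
    fun σ c y => Fintype.sum_equiv σ _ _ fun _ => rfl
  have hΦcomp : ∀ (σ : Equiv.Perm ι) (c : ι → ZMod 2), Φ (c ∘ σ) =
      ∑ y : ι → ZMod 2, if hammingNorm y = w ∧ T ⊆ wordSupport (y ∘ σ) then
        (sgn (c ⬝ᵥ y) : ℚ) else 0 := by
    intro σ c
    refine (Fintype.sum_equiv (Equiv.arrowCongr σ.symm (Equiv.refl _)) _ _ fun y => ?_).symm
    have : (Equiv.arrowCongr σ.symm (Equiv.refl (ZMod 2))) y = y ∘ σ := by
      funext i
      simp
    rw [this, hammingNorm_comp_perm, hdot]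
  have hsum : ∀ σ : Equiv.Perm ι, ∑ c ∈ words C, Φ (c ∘ σ) =
      (words C).card * (((codewordsOfWeight (dualCode C) w).filter
        fun c => T ⊆ wordSupport (c ∘ σ)).card : ℚ) := by
    intro σ
    simp only [hΦcomp]
    rw [Finset.sum_comm]
    have : ∀ y : ι → ZMod 2, ∑ c ∈ words C,
        (if hammingNorm y = w ∧ T ⊆ wordSupport (y ∘ σ) then (sgn (c ⬝ᵥ y) : ℚ) else 0) =
        if (y ∈ dualCode C ∧ hammingNorm y = w) ∧ T ⊆ wordSupport (y ∘ σ) then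
          ((words C).card : ℚ) else 0 := by
      intro y
      by_cases h : hammingNorm y = w ∧ T ⊆ wordSupport (y ∘ σ)
      · simp only [h, and_true, if_true]
        rw [← Int.cast_sum, sum_words_sgn]
        split_ifs <;> simp
      · rw [if_neg (fun h' => h ⟨h'.1.2, h'.2⟩)]
        simp [h]
    rw [Finset.sum_congr rfl fun y _ => this y, ← Finset.sum_filter, Finset.sum_const,
      nsmul_eq_mul, mul_comm]
    congr 3
    ext y
    simp [codewordsOfWeight]
  have hmain := sum_words_comp_perm C hd V T (hT ▸ hVt) hV Φ (by
    intro σ hσ c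
    rw [hΦcomp]
    simp only [subset_wordSupport_comp hσ, hΦ]) π
  have h1 := hsum 1
  simp only [Equiv.Perm.coe_one, Function.comp_id] at h1
  rw [hsum π, h1] at hmain
  have hpos : ((words C).card : ℚ) ≠ 0 := by
    exact_mod_cast (words_card_pos C).ne'
  exact_mod_cast mul_left_cancel₀ hpos hmain

end AssmusMattson

/-! ### Power moments of a code in terms of the dual weights. -/

section PowerMoments

variable {ι : Type*} [Fintype ι]

/-- The sum of the signs of a word. -/
def signSum (c : ι → ZMod 2) : ℤ := ∑ i, sgn (c i)

lemma signSum_eq (c : ι → ZMod 2) : signSum c = Fintype.card ι - 2 * hammingNorm c := by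
  classical
  have h : ∀ i, sgn (c i) = 1 - 2 * if c i ≠ 0 then 1 else 0 := fun i => by
    by_cases hc : c i = 0 <;> simp [sgn, hc]
  simp only [signSum, h, Finset.sum_sub_distrib, ← Finset.mul_sum, Finset.sum_boole]
  simp [hammingNorm]

/-- The number of ways to write a word of weight `w` and length `q` as an ordered sum of `n` words
of weight one. -/
def unitSumCount (q : ℤ) : ℕ → ℕ → ℤ
  | 0, w => if w = 0 then 1 else 0
  -- The last unit word lies inside the support or outside it. The truncated `w - 1` at `w = 0` is
  -- killed by the factor `w`.
  | n + 1, w => w * unitSumCount q n (w - 1) + (q - w) * unitSumCount q n (w + 1)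

lemma unitSumCount_eq_zero (q : ℤ) {n w : ℕ} (h : n < w) : unitSumCount q n w = 0 := by
  induction n generalizing w with
  | zero => simp [unitSumCount, h.ne']
  | succ n ih => rw [unitSumCount, ih (by omega), ih (by omega)]; ring

lemma hammingNorm_add_single [DecidableEq ι] (y : ι → ZMod 2) (p : ι) :
    hammingNorm (y + Pi.single p 1) =
      if y p = 0 then hammingNorm y + 1 else hammingNorm y - 1 := by
  split_ifs with h
  · have : wordSupport (y + Pi.single p 1) = insert p (wordSupport y) := by
      ext i
      by_cases hi : i = p
      · subst hi; simp [h]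
      · simp [hi]
    rw [← card_wordSupport, this, Finset.card_insert_of_notMem (by simpa using h)]
    rfl
  · have : wordSupport (y + Pi.single p 1) = (wordSupport y).erase p := by
      ext i
      by_cases hi : i = p
      · subst hi
        simp only [mem_wordSupport, Pi.add_apply, zmod_two_eq_one h, Pi.single_eq_same]
        simp
        decide
      · simp [hi]
    rw [← card_wordSupport, this, Finset.card_erase_of_mem (by simpa using h)]
    rfl

-- Each sign is the character of a unit word, so the `n`-th power expands into characters of sums of
-- `n` unit words; grouping by the sum gives the coefficients.
open Classical in
lemma signSum_pow (c : ι → ZMod 2) (n : ℕ) :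
    signSum c ^ n =
      ∑ y : ι → ZMod 2, unitSumCount (Fintype.card ι) n (hammingNorm y) * sgn (c ⬝ᵥ y) := by
  induction n with
  | zero => simp [unitSumCount]
  | succ n ih =>
    have hstep : ∀ y : ι → ZMod 2,
        unitSumCount (Fintype.card ι) (n + 1) (hammingNorm y) =
          ∑ p, unitSumCount (Fintype.card ι) n (hammingNorm (y + Pi.single p 1)) := by
      intro y
      simp only [hammingNorm_add_single, apply_ite (unitSumCount (Fintype.card ι) n)]
      rw [Finset.sum_ite, Finset.sum_const, Finset.sum_const, unitSumCount]
      have h1 : (Finset.univ.filter fun i => ¬ y i = 0).card = hammingNorm y := rfl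
      have h2 := Finset.card_filter_add_card_filter_not (s := Finset.univ) (fun i => y i = 0)
      rw [h1, Finset.card_univ] at h2
      rw [h1, ← h2]
      push_cast
      simp only [nsmul_eq_mul]
      ring
    rw [pow_succ, ih, signSum, Finset.mul_sum]
    simp only [hstep, Finset.sum_mul]
    rw [Finset.sum_comm (s := Finset.univ (α := ι → ZMod 2))]
    refine Finset.sum_congr rfl fun p _ => ?_
    refine Fintype.sum_equiv (Equiv.addRight (Pi.single p (1 : ZMod 2))) _ _ fun y => ?_
    have h2 : y + Pi.single p 1 + Pi.single p 1 = y := by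
      rw [add_assoc, ← Pi.single_add, show (1 : ZMod 2) + 1 = 0 from rfl]
      simp
    simp only [Equiv.coe_addRight, h2, dotProduct_add, sgn_add, dotProduct_single_one]
    ring

/-- The power moments of a binary code in terms of the weights of the dual code. -/
theorem sum_words_signSum_pow (C : Submodule (ZMod 2) (ι → ZMod 2)) (n : ℕ) :
    ∑ c ∈ words C, signSum c ^ n = (words C).card *
      ∑ y ∈ words (dualCode C), unitSumCount (Fintype.card ι) n (hammingNorm y) := by
  classical
  simp only [signSum_pow]
  rw [Finset.sum_comm]
  simp only [← Finset.mul_sum, sum_words_sgn]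
  rw [show words (dualCode C) = Finset.univ.filter (· ∈ dualCode C) by ext; simp,
    Finset.sum_filter, Finset.mul_sum]
  refine Finset.sum_congr rfl fun y _ => ?_
  split_ifs <;> ring

lemma words_filter_hammingNorm (C : Submodule (ZMod 2) (ι → ZMod 2)) (w : ℕ) :
    (words C).filter (fun c => hammingNorm c = w) = codewordsOfWeight C w := by
  ext c
  simp [mem_codewordsOfWeight]

/-- The first power moments of a code whose dual has only the weights `0`, `6` and weights at
least `8`. -/
theorem sum_words_signSum_pow_of_le (C : Submodule (ZMod 2) (ι → ZMod 2))
    (h : ∀ y ∈ dualCode C, y ≠ 0 → hammingNorm y = 6 ∨ 8 ≤ hammingNorm y) {n : ℕ} (hn : n ≤ 8) :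
    ∑ c ∈ words C, signSum c ^ n = (words C).card *
      (unitSumCount (Fintype.card ι) n 0 +
        weightCount (dualCode C) 6 * unitSumCount (Fintype.card ι) n 6 +
        weightCount (dualCode C) 8 * unitSumCount (Fintype.card ι) n 8) := by
  classical
  rw [sum_words_signSum_pow]
  congr 1
  have key : ∀ y ∈ words (dualCode C), unitSumCount (Fintype.card ι) n (hammingNorm y) =
      (if hammingNorm y = 0 then unitSumCount (Fintype.card ι) n 0 else 0) +
      (if hammingNorm y = 6 then unitSumCount (Fintype.card ι) n 6 else 0) +
      (if hammingNorm y = 8 then unitSumCount (Fintype.card ι) n 8 else 0) := by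
    intro y hy
    by_cases h0 : y = 0
    · simp [h0]
    · have hne := hammingNorm_ne_zero_iff.2 h0
      rcases h y (mem_words.1 hy) h0 with h6 | h8
      · simp [h6]
      · rcases h8.eq_or_lt with h8 | h8
        · simp [← h8]
        · rw [unitSumCount_eq_zero _ (by omega), if_neg (by omega), if_neg (by omega),
            if_neg (by omega)]
          simp
  have h0 : codewordsOfWeight (dualCode C) 0 = {0} := by
    ext c
    simp only [mem_codewordsOfWeight, hammingNorm_eq_zero, Finset.mem_singleton]
    exact ⟨fun h => h.2, fun h => ⟨h ▸ Submodule.zero_mem _, h⟩⟩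
  rw [Finset.sum_congr rfl key]
  simp only [Finset.sum_add_distrib, ← Finset.sum_filter, Finset.sum_const,
    words_filter_hammingNorm, weightCount, h0, nsmul_eq_mul]
  simp

end PowerMoments

/-! ### Double counting for the parameter of a design. -/

section Counting

variable {ι : Type*} [Fintype ι]

lemma nodup_supportBlocks (C : Submodule (ZMod 2) (ι → ZMod 2)) (w : ℕ) :
    (supportBlocks C w).Nodup :=
  (codewordsOfWeight C w).nodup.map wordSupport_injective

/-- Double counting of the incidences of `t`-sets and blocks. -/
lemma IsDesign.mul_choose {t v k lam : ℕ} {C : Submodule (ZMod 2) (ι → ZMod 2)}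
    (h : IsDesign t v k lam (supportBlocks C k)) :
    lam * v.choose t = weightCount C k * k.choose t := by
  classical
  obtain ⟨hv, -, hT⟩ := h
  have hcount := Finset.sum_card_bipartiteAbove_eq_sum_card_bipartiteBelow
    (s := Finset.univ.powersetCard t) (t := codewordsOfWeight C k)
    (fun (T : Finset ι) c => T ⊆ wordSupport c)
  have h1 : ∀ T ∈ Finset.univ.powersetCard t,
      ((codewordsOfWeight C k).bipartiteAbove (fun (T : Finset ι) c => T ⊆ wordSupport c) T).card =
        lam := by
    intro T hTt
    rw [← hT T (Finset.mem_powersetCard.1 hTt).2]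
    rw [countP_supportBlocks, Finset.bipartiteAbove]
  have h2 : ∀ c ∈ codewordsOfWeight C k,
      ((Finset.univ.powersetCard t).bipartiteBelow
        (fun (T : Finset ι) c => T ⊆ wordSupport c) c).card = k.choose t := by
    intro c hc
    rw [← (mem_codewordsOfWeight.1 hc).2, ← card_wordSupport, ← Finset.card_powersetCard]
    congr 1
    ext T
    simp [Finset.bipartiteBelow, Finset.mem_powersetCard, and_comm]
  rw [Finset.sum_congr rfl h1, Finset.sum_congr rfl h2] at hcount
  simp only [Finset.sum_const, Finset.card_powersetCard, Finset.card_univ, hv, smul_eq_mul]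
    at hcount
  rw [mul_comm, hcount, weightCount]

lemma cast_choose_three (n : ℕ) : (n.choose 3 : ℚ) = n * (n - 1) * (n - 2) / 6 := by
  induction n with
  | zero => simp
  | succ n ih =>
    rw [Nat.choose_succ_succ', Nat.cast_add, Nat.cast_choose_two, ih]
    push_cast
    ring

end Counting

/-! ### Zeros of polynomials in a field automorphism. -/

section SkewPolynomials

variable {F : Type*} [Field F] [Fintype F] [DecidableEq F]

lemma sum_range_mul_eq_by_parts {R : Type*} [CommRing R] (b z : ℕ → R) (n : ℕ) :
    ∑ i ∈ Finset.range (n + 1), b i * z i =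
      (∑ i ∈ Finset.range (n + 1), b i) * z n -
        ∑ j ∈ Finset.range n, (∑ i ∈ Finset.range (j + 1), b i) * (z (j + 1) - z j) := by
  induction n with
  | zero => simp
  | succ n ih =>
    rw [Finset.sum_range_succ, ih, Finset.sum_range_succ (fun j => _ * (z (j + 1) - z j)),
      Finset.sum_range_succ b (n + 1)]
    ring

/-- A nonzero polynomial of degree at most `n` in an automorphism whose only fixed points are `0`
and `1` has at most `2 ^ n` zeros. -/
theorem card_zeros_skew_le (σ : F ≃+* F) (hσ : ∀ x, σ x = x → x = 0 ∨ x = 1) (n : ℕ)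
    (a : ℕ → F) (ha : ∃ i ≤ n, a i ≠ 0) :
    (Finset.univ.filter fun x =>
      ∑ i ∈ Finset.range (n + 1), a i * (σ^[i]) x = 0).card ≤ 2 ^ n := by
  induction n generalizing a with
  | zero =>
    obtain ⟨i, hi, ha⟩ := ha
    obtain rfl : i = 0 := by omega
    simp [ha, Finset.filter_eq']
  | succ n ih =>
    set Z := Finset.univ.filter fun x =>
      ∑ i ∈ Finset.range (n + 1 + 1), a i * (σ^[i]) x = 0 with hZ
    by_cases hv : ∃ v ∈ Z, v ≠ 0
    swap
    · push Not at hv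
      calc Z.card ≤ ({0} : Finset F).card :=
            Finset.card_le_card fun x hx => by simpa using hv x hx
        _ ≤ 2 ^ (n + 1) := by simpa using Nat.one_le_two_pow
    -- Rescaling by a nonzero zero `v` makes $1$ a zero, so the new coefficients `b` sum to zero.
    -- Summation by parts then factors $\sigma-1$ out on the right, leaving a polynomial of degree
    -- at most `n` with the partial sums `B` as coefficients.
    obtain ⟨v, hvZ, hv0⟩ := hv
    have hmul : ∀ i x y, (σ^[i]) (x * y) = (σ^[i]) x * (σ^[i]) y := fun i =>
      iterate_map_mul σ i
    have hsub : ∀ i x y, (σ^[i]) (x - y) = (σ^[i]) x - (σ^[i]) y := fun i =>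
      iterate_map_sub σ i
    set b : ℕ → F := fun i => a i * (σ^[i]) v with hb
    set B : ℕ → F := fun j => ∑ i ∈ Finset.range (j + 1), b i with hB
    have hBtop : B (n + 1) = 0 := by
      simpa [hZ] using hvZ
    have hroot : ∀ y, v * y ∈ Z ↔
        ∑ j ∈ Finset.range (n + 1), B j * (σ^[j]) (σ y - y) = 0 := by
      intro y
      have h1 : ∑ i ∈ Finset.range (n + 1 + 1), a i * (σ^[i]) (v * y) =
          ∑ i ∈ Finset.range (n + 1 + 1), b i * (σ^[i]) y :=
        Finset.sum_congr rfl fun i _ => by rw [hmul, hb]; ring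
      have h2 : ∀ j, (σ^[j + 1]) y - (σ^[j]) y = (σ^[j]) (σ y - y) := fun j => by
        rw [hsub, Function.iterate_succ_apply]
      have h3 := sum_range_mul_eq_by_parts b (fun i => (σ^[i]) y) (n + 1)
      simp only [h2] at h3
      rw [hZ, Finset.mem_filter, h1, h3]
      change (_ ∧ B (n + 1) * _ - ∑ j ∈ Finset.range (n + 1), B j * _ = 0) ↔ _
      rw [hBtop]
      simp
    have hBne : ∃ i ≤ n, B i ≠ 0 := by
      by_contra! hall
      have hall' : ∀ i ≤ n + 1, B i = 0 := fun i hi => by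
        rcases hi.lt_or_eq with h | rfl
        · exact hall i (by omega)
        · exact hBtop
      obtain ⟨i, hi, hai⟩ := ha
      have hbi : b i = 0 := by
        cases i with
        | zero => simpa [hB] using hall' 0 (by omega)
        | succ i =>
          have h1 := hall' (i + 1) hi
          have h2 := hall' i (by omega)
          simp only [hB] at h1 h2
          rw [Finset.sum_range_succ, h2, zero_add] at h1
          exact h1
      refine hai ((mul_eq_zero.1 hbi).resolve_right fun h0 => hv0 ?_)
      exact (σ.injective.iterate i) (by rw [h0, iterate_map_zero])
    set Z' := Finset.univ.filter fun x =>
      ∑ i ∈ Finset.range (n + 1), B i * (σ^[i]) x = 0 with hZ'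
    set g : F → F := fun x => σ (x / v) - x / v with hg
    have himg : Z.image g ⊆ Z' := by
      intro z hz
      obtain ⟨x, hx, rfl⟩ := Finset.mem_image.1 hz
      rw [hZ', Finset.mem_filter]
      exact ⟨Finset.mem_univ _, (hroot (x / v)).1 (by rwa [mul_div_cancel₀ _ hv0])⟩
    -- The kernel of $\sigma-1$ is contained in $\{0,1\}$, so passing to the quotient polynomial at
    -- most halves the number of zeros.
    have hfib : ∀ z ∈ Z.image g, (Z.filter fun x => g x = z).card ≤ 2 := by
      intro z hz
      obtain ⟨x, hx, rfl⟩ := Finset.mem_image.1 hz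
      refine (Finset.card_le_card (t := {x, x + v}) fun x' hx' => ?_).trans Finset.card_le_two
      have h := (Finset.mem_filter.1 hx').2
      have hfix : σ (x' / v - x / v) = x' / v - x / v := by
        rw [map_sub]
        simp only [hg] at h
        linear_combination h
      rw [Finset.mem_insert, Finset.mem_singleton]
      rcases hσ _ hfix with h0 | h1
      · left
        field_simp at h0
        linear_combination h0
      · right
        field_simp at h1
        linear_combination h1
    calc Z.card ≤ 2 * (Z.image g).card := Finset.card_le_mul_card_image _ _ hfib
      _ ≤ 2 * Z'.card := Nat.mul_le_mul_left _ (Finset.card_le_card himg)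
      _ ≤ 2 * 2 ^ n := Nat.mul_le_mul_left _ (ih B hBne)
      _ = 2 ^ (n + 1) := by ring

end SkewPolynomials

/-! ### Quadratic trace functions and their polarization. -/

section QuadraticFunctions

variable {F : Type*} [Field F] [Algebra (ZMod 2) F]

lemma two_eq_zero_of_algebra : (2 : F) = 0 := by
  have h := map_ofNat (algebraMap (ZMod 2) F) 2
  rw [show (OfNat.ofNat 2 : ZMod 2) = 0 from rfl, map_zero] at h
  exact h.symm

/-- The quadratic function attached to an automorphism. -/
noncomputable def quadTrace (σ : F ≃ₐ[ZMod 2] F) (a b c x : F) : ZMod 2 :=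
  Algebra.trace (ZMod 2) F (a * (x * σ (σ x)) + b * (x * σ x) + c * x)

/-- The linear map representing the bilinear form of `quadTrace`. -/
noncomputable def polarMap (σ : F ≃ₐ[ZMod 2] F) (a b : F) : F →+ F :=
  AddMonoidHom.mk' (fun y => a * σ (σ y) + σ.symm (σ.symm (a * y)) + b * σ y + σ.symm (b * y))
    (fun x y => by simp only [map_add, mul_add]; ring)

/-- The trace is invariant under `σ`, which allows `σ` to be moved from `x` to the other factor as
its inverse. -/
lemma quadTrace_add (σ : F ≃ₐ[ZMod 2] F) (a b c x y : F) :
    quadTrace σ a b c (x + y) = quadTrace σ a b c x + quadTrace σ a b c y +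
      Algebra.trace (ZMod 2) F (x * polarMap σ a b y) := by
  have h1 : ∀ z, Algebra.trace (ZMod 2) F z = Algebra.trace (ZMod 2) F (σ z) := fun z =>
    (Algebra.trace_eq_of_algEquiv σ z).symm
  have h2 : Algebra.trace (ZMod 2) F (x * σ.symm (σ.symm (a * y))) =
      Algebra.trace (ZMod 2) F (a * (y * σ (σ x))) := by
    rw [h1, h1]
    congr 1
    simp
    ring
  have h3 : Algebra.trace (ZMod 2) F (x * σ.symm (b * y)) =
      Algebra.trace (ZMod 2) F (b * (y * σ x)) := by
    rw [h1]
    congr 1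
    simp
    ring
  simp only [quadTrace, polarMap, AddMonoidHom.mk'_apply, mul_add, map_add, h2, h3, add_mul]
  rw [mul_left_comm x a, mul_left_comm x b]
  ring

/-- The function `x * σ x` is almost perfect nonlinear. -/
lemma eq_or_eq_of_sum_four (σ : F ≃ₐ[ZMod 2] F) (hσ : ∀ x, σ x = x → x = 0 ∨ x = 1)
    {x y z w : F} (h1 : x + y + z + w = 0) (h2 : x * σ x + y * σ y + z * σ z + w * σ w = 0)
    (hxy : x ≠ y) : z = x ∨ z = y := by
  have two : (2 : F) = 0 := two_eq_zero_of_algebra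
  have hw : w = x + y + z := by linear_combination h1 - (x + y + z) * two
  have hd : y - x ≠ 0 := sub_ne_zero.2 hxy.symm
  -- After eliminating `w`, the second equation reads $(z-x)\,\sigma(y-x)=(y-x)\,\sigma(z-x)$ in
  -- characteristic two.
  have hfix : σ ((z - x) / (y - x)) = (z - x) / (y - x) := by
    have hd' : σ y - σ x ≠ 0 := by
      rw [← map_sub]
      exact (map_ne_zero σ).2 hd
    rw [map_div₀, map_sub, map_sub, div_eq_div_iff hd' hd]
    rw [hw, map_add, map_add] at h2
    linear_combination h2 - (x * σ x + y * σ y + z * σ z + x * σ z + y * σ x + z * σ y) * two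
  rcases hσ _ hfix with h | h
  · left
    rw [div_eq_zero_iff, or_iff_left hd] at h
    exact sub_eq_zero.1 h
  · right
    rw [div_eq_one_iff_eq hd] at h
    linear_combination h

lemma quadTrace_sub (σ : F ≃ₐ[ZMod 2] F) (a b c a' b' c' x : F) :
    quadTrace σ (a - a') (b - b') (c - c') x = quadTrace σ a b c x - quadTrace σ a' b' c' x := by
  rw [quadTrace, quadTrace, quadTrace, ← map_sub]
  congr 1
  ring

end QuadraticFunctions

/-! ### Exponential sums of quadratic functions. -/

section QuadraticSums

variable {F : Type*} [Field F] [Fintype F] [Algebra (ZMod 2) F]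

lemma exists_trace_mul_ne_zero {y : F} (hy : y ≠ 0) :
    ∃ x, Algebra.trace (ZMod 2) F (x * y) ≠ 0 := by
  have htr := (traceForm_nondegenerate (ZMod 2) F).1 y
  simp_rw [Algebra.traceForm_apply] at htr
  by_contra! h
  exact hy (htr fun x => by rw [mul_comm]; exact h x)

lemma sum_sgn_add_hom {G : Type*} [AddCommGroup G] [Fintype G] (f : G → ZMod 2)
    (hf : ∀ x y, f (x + y) = f x + f y) :
    ∑ x, sgn (f x) = 0 ∨ ∑ x, sgn (f x) = Fintype.card G := by
  by_cases h : ∃ d, f d ≠ 0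
  · left
    obtain ⟨d, hd⟩ := h
    have h1 : ∑ x, sgn (f x) = ∑ x, sgn (f (x + d)) :=
      (Fintype.sum_equiv (Equiv.addRight d) _ _ fun _ => rfl).symm
    simp only [hf, sgn_add, zmod_two_eq_one hd, ← Finset.sum_mul] at h1
    simp only [sgn, one_ne_zero, if_false] at h1 ⊢
    omega
  · right
    push Not at h
    simp [h]

lemma sum_sgn_trace_mul {y : F} (hy : y ≠ 0) :
    ∑ x : F, sgn (Algebra.trace (ZMod 2) F (x * y)) = 0 := by
  obtain ⟨d, hd⟩ := exists_trace_mul_ne_zero hy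
  have h1 : ∑ x : F, sgn (Algebra.trace (ZMod 2) F (x * y)) =
      ∑ x : F, sgn (Algebra.trace (ZMod 2) F ((x + d) * y)) :=
    (Fintype.sum_equiv (Equiv.addRight d) _ _ fun _ => rfl).symm
  simp only [add_mul, map_add, sgn_add, zmod_two_eq_one hd, ← Finset.sum_mul] at h1
  simp only [sgn, one_ne_zero, if_false] at h1 ⊢
  omega

/-- The square of the exponential sum of a quadratic function, in terms of the radical of the
associated bilinear form. -/
theorem sq_sum_sgn_quadratic (Q : F → ZMod 2) (R : F →+ F)
    (hQ : ∀ x y, Q (x + y) = Q x + Q y + Algebra.trace (ZMod 2) F (x * R y)) :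
    (∑ x, sgn (Q x)) ^ 2 = 0 ∨
      (∑ x, sgn (Q x)) ^ 2 = Fintype.card F * Nat.card R.ker := by
  classical
  -- In the double sum, replacing `y` by `x + y` cancels the sign of `Q x`; the sum over `x` then
  -- vanishes unless `y` is in the radical. On the radical `Q` is additive, so the remaining sum is
  -- zero or full.
  have hsq : (∑ x, sgn (Q x)) ^ 2 = Fintype.card F * ∑ y : R.ker, sgn (Q y) := by
    have h1 : ∀ x, sgn (Q x) * ∑ y, sgn (Q y) = ∑ y, sgn (Q y) *
        sgn (Algebra.trace (ZMod 2) F (x * R y)) := by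
      intro x
      rw [← Fintype.sum_equiv (Equiv.addLeft x) (fun y => sgn (Q (x + y))) _ fun _ => rfl,
        Finset.mul_sum]
      refine Finset.sum_congr rfl fun y _ => ?_
      rw [hQ, sgn_add, sgn_add]
      linear_combination sgn (Q y) * sgn (Algebra.trace (ZMod 2) F (x * R y)) *
        sgn_mul_self (Q x)
    rw [sq, Finset.sum_mul, Finset.sum_congr rfl fun x _ => h1 x, Finset.sum_comm]
    have h2 : ∀ y, ∑ x, sgn (Q y) * sgn (Algebra.trace (ZMod 2) F (x * R y)) =
        if y ∈ R.ker then Fintype.card F * sgn (Q y) else 0 := by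
      intro y
      rw [← Finset.mul_sum]
      split_ifs with hy
      · rw [AddMonoidHom.mem_ker.1 hy]
        simp [mul_comm]
      · rw [sum_sgn_trace_mul (fun h => hy (AddMonoidHom.mem_ker.2 h)), mul_zero]
    rw [Finset.sum_congr rfl fun y _ => h2 y, ← Finset.sum_filter, ← Finset.mul_sum]
    congr 1
    exact Finset.sum_subtype _ (by simp) _
  rcases sum_sgn_add_hom (fun y : R.ker => Q y) (fun x y => by
    simp [hQ, AddMonoidHom.mem_ker.1 y.2]) with h | h
  · left
    rw [hsq, h, mul_zero]
  · right
    rw [hsq, h, Nat.card_eq_fintype_card]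

lemma exists_eq_two_pow_of_sq_eq {W : ℤ} {n : ℕ} (h : W ^ 2 = 2 ^ n) : Even n := by
  have h1 : W.natAbs ^ 2 = 2 ^ n := by
    zify
    rw [sq_abs, h]
  have hdvd : W.natAbs ∣ 2 ^ n := h1 ▸ dvd_pow_self _ two_ne_zero
  obtain ⟨j, -, hj⟩ := (Nat.dvd_prime_pow Nat.prime_two).1 hdvd
  rw [hj, ← pow_mul] at h1
  have := Nat.pow_right_injective le_rfl h1
  exact ⟨j, by omega⟩

/-- Applying $\sigma^2$ removes the inverses:
$\sigma^2(a)\sigma^4(y)+\sigma^2(b)\sigma^3(y)+\sigma(b)\sigma(y)+ay=0$, of degree at most $4$ in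
`σ`. -/
lemma card_ker_polarMap_le (σ : F ≃ₐ[ZMod 2] F) (hσ : ∀ x, σ x = x → x = 0 ∨ x = 1) {a b : F}
    (hab : a ≠ 0 ∨ b ≠ 0) : Nat.card (polarMap σ a b).ker ≤ 2 ^ 4 := by
  classical
  set p : ℕ → F := fun i => match i with
    | 0 => a
    | 1 => σ b
    | 2 => 0
    | 3 => σ (σ b)
    | 4 => σ (σ a)
    | _ => 0 with hp
  have h := card_zeros_skew_le σ.toRingEquiv hσ 4 p (by
    rcases hab with h | h
    · exact ⟨0, by norm_num, h⟩
    · exact ⟨1, by norm_num, by simpa [hp] using h⟩)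
  refine le_trans ?_ h
  rw [Nat.card_eq_fintype_card, Fintype.card_of_subtype
    (Finset.univ.filter (· ∈ (polarMap σ a b).ker)) (by simp)]
  refine Finset.card_le_card fun y hy => ?_
  rw [Finset.mem_filter_univ, AddMonoidHom.mem_ker] at hy
  have h2 := congrArg (fun z => σ (σ z)) hy
  simp only [polarMap, AddMonoidHom.mk'_apply, map_add, map_mul, AlgEquiv.apply_symm_apply,
    map_zero] at h2
  simp only [Finset.mem_filter, Finset.mem_univ, true_and, Finset.sum_range_succ, hp,
    Finset.sum_range_zero, Function.iterate_succ_apply, Function.iterate_zero_apply]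
  change 0 + a * y + σ b * σ y + 0 * σ (σ y) + σ (σ b) * σ (σ (σ y)) +
    σ (σ a) * σ (σ (σ (σ y))) = 0
  linear_combination h2

/-- The possible squares of the exponential sums, the degree of the field being odd. -/
theorem sq_sum_sgn_quadTrace (σ : F ≃ₐ[ZMod 2] F) (hσ : ∀ x, σ x = x → x = 0 ∨ x = 1) {m : ℕ}
    (hF : Fintype.card F = 2 ^ m) (hm : Odd m) {a b : F} (hab : a ≠ 0 ∨ b ≠ 0) (c : F) :
    (∑ x, sgn (quadTrace σ a b c x)) ^ 2 = 0 ∨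
      (∑ x, sgn (quadTrace σ a b c x)) ^ 2 = 2 * 2 ^ m ∨
      (∑ x, sgn (quadTrace σ a b c x)) ^ 2 = 8 * 2 ^ m := by
  rcases sq_sum_sgn_quadratic _ _ (quadTrace_add σ a b c) with h | h
  · exact Or.inl h
  right
  have hdvd : Nat.card (polarMap σ a b).ker ∣ 2 ^ m := by
    rw [← hF, ← Nat.card_eq_fintype_card]
    exact AddSubgroup.card_addSubgroup_dvd_card _
  obtain ⟨r, -, hr⟩ := (Nat.dvd_prime_pow Nat.prime_two).1 hdvd
  have hr4 : r ≤ 4 := by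
    have := card_ker_polarMap_le σ hσ hab
    rw [hr] at this
    exact (Nat.pow_le_pow_iff_right (by norm_num)).1 this
  rw [hF, hr] at h
  push_cast at h
  rw [← pow_add] at h
  have heven := exists_eq_two_pow_of_sq_eq h
  -- The square equals $2^{m+r}$, so $m+r$ is even while `m` is odd; only $r=1$ and $r=3$ survive.
  have hrodd : Odd r := by
    rw [Nat.even_add] at heven
    rw [← Nat.not_even_iff_odd] at hm ⊢
    tauto
  rw [pow_add] at h
  rw [h]
  interval_cases r
  · simp at hrodd
  · left; ring
  · exact absurd hrodd (by decide)
  · right; ring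
  · exact absurd hrodd (by decide)

end QuadraticSums

/-! ### The automorphism $x\mapsto x^{2^e}$. -/

section FrobeniusPower

variable (F : Type*) [Field F] [Fintype F] [Algebra (ZMod 2) F]

/-- The automorphism `x ↦ x ^ (2 ^ e)`. -/
noncomputable def frobPow (e : ℕ) : F ≃ₐ[ZMod 2] F :=
  FiniteField.frobeniusAlgEquivOfAlgebraic (ZMod 2) F ^ e

variable {F}

lemma frobPow_apply (e : ℕ) (x : F) : frobPow F e x = x ^ 2 ^ e := by
  rw [frobPow, AlgEquiv.coe_pow, FiniteField.coe_frobeniusAlgEquivOfAlgebraic_iterate, ZMod.card]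

/-- A fixed point has periods `m` and `e` under squaring, hence period $\gcd(m,e)=1$, so $x^2=x$. -/
lemma frobPow_fixed {m e : ℕ} (hF : Fintype.card F = 2 ^ m) (hgcd : Nat.gcd m e = 1) (x : F)
    (hx : frobPow F e x = x) : x = 0 ∨ x = 1 := by
  have h1 : Function.IsPeriodicPt (fun y : F => y ^ 2) m x := by
    rw [Function.IsPeriodicPt, Function.IsFixedPt, pow_iterate, ← hF]
    exact FiniteField.pow_card x
  have h2 : Function.IsPeriodicPt (fun y : F => y ^ 2) e x := by
    rw [Function.IsPeriodicPt, Function.IsFixedPt, pow_iterate]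
    simpa only [frobPow_apply] using hx
  have h3 := h1.gcd h2
  rw [hgcd, Function.IsPeriodicPt, Function.iterate_one, Function.IsFixedPt] at h3
  have h4 : x * (x - 1) = 0 := by linear_combination h3
  rcases mul_eq_zero.1 h4 with h | h
  · exact Or.inl h
  · exact Or.inr (sub_eq_zero.1 h)

lemma trace_eq_quadTrace (e : ℕ) (a b c x : F) :
    Algebra.trace (ZMod 2) F (a * x ^ (2 ^ (2 * e) + 1) + b * x ^ (2 ^ e + 1) + c * x) =
      quadTrace (frobPow F e) a b c x := by
  rw [quadTrace, frobPow_apply, frobPow_apply, ← pow_mul, ← pow_add, ← two_mul, pow_succ' x,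
    pow_succ' x]

end FrobeniusPower

/-! ### Field elements as coordinates. -/

section EvalPoint

variable {F : Type*} [Field F]

variable (F) in
/-- The coordinates of the extended code are the elements of the field. -/
noncomputable def evalPoint : Option Fˣ ≃ F :=
  Equiv.ofBijective (fun o => o.elim 0 fun u => (u : F)) (by
    constructor
    · rintro (_ | u) (_ | v) h
      · rfl
      · exact absurd h.symm v.ne_zero
      · exact absurd h u.ne_zero
      · exact congrArg some (Units.ext h)
    · intro x
      by_cases hx : x = 0
      · exact ⟨none, hx.symm⟩
      · exact ⟨some (Units.mk0 x hx), rfl⟩)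

@[simp] lemma evalPoint_none : evalPoint F none = 0 := rfl

@[simp] lemma evalPoint_some (u : Fˣ) : evalPoint F (some u) = u := rfl

lemma card_option_units [Fintype F] [DecidableEq F] : Fintype.card (Option Fˣ) = Fintype.card F :=
  Fintype.card_congr (evalPoint F)

end EvalPoint

/-! ### The words of the extended code and the small weights of its dual. -/

section CodeE

lemma two_zmod_two : (2 : ZMod 2) = 0 := rfl

lemma sum_eq_cast_hammingNorm {ι : Type*} [Fintype ι] (c : ι → ZMod 2) :
    ∑ i, c i = (hammingNorm c : ZMod 2) := by
  have h : ∀ i, c i = if c i ≠ 0 then 1 else 0 := fun i => by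
    split_ifs with hc
    · exact zmod_two_eq_one hc
    · exact not_not.1 hc
  rw [Finset.sum_congr rfl fun i _ => h i, Finset.sum_boole]
  rfl

variable {F : Type*} [Field F] [Fintype F] [Algebra (ZMod 2) F]

/-- The exponential sums of `quadTrace` take five values apart from the trivial one. -/
lemma sq_sum_sgn_quadTrace_or (σ : F ≃ₐ[ZMod 2] F) (hσ : ∀ x, σ x = x → x = 0 ∨ x = 1) {m : ℕ}
    (hF : Fintype.card F = 2 ^ m) (hm : Odd m) (a b c : F) :
    (a = 0 ∧ b = 0 ∧ c = 0) ∨ (∑ x, sgn (quadTrace σ a b c x)) ^ 2 = 0 ∨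
      (∑ x, sgn (quadTrace σ a b c x)) ^ 2 = 2 * 2 ^ m ∨
      (∑ x, sgn (quadTrace σ a b c x)) ^ 2 = 8 * 2 ^ m := by
  by_cases hab : a ≠ 0 ∨ b ≠ 0
  · exact Or.inr (sq_sum_sgn_quadTrace σ hσ hF hm hab c)
  push Not at hab
  obtain ⟨rfl, rfl⟩ := hab
  by_cases hc : c = 0
  · exact Or.inl ⟨rfl, rfl, hc⟩
  · right; left
    have h := sum_sgn_trace_mul hc
    simp only [quadTrace, zero_mul, zero_add]
    simp only [mul_comm c, h]
    norm_num

/-- The exponential sum is $q$ minus twice the weight. Its square is divisible by $16$, so the sum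
is divisible by $4$, as is $q$; the weight is therefore even. -/
lemma sum_quadTrace (σ : F ≃ₐ[ZMod 2] F) (hσ : ∀ x, σ x = x → x = 0 ∨ x = 1) {m : ℕ}
    (hF : Fintype.card F = 2 ^ m) (hm : Odd m) (hm5 : 5 ≤ m) (a b c : F) :
    ∑ x, quadTrace σ a b c x = 0 := by
  obtain ⟨n, rfl⟩ := Nat.exists_eq_add_of_le hm5
  have h4 : (4 : ℤ) ∣ ∑ x, sgn (quadTrace σ a b c x) := by
    rcases sq_sum_sgn_quadTrace_or σ hσ hF hm a b c with ⟨rfl, rfl, rfl⟩ | h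
    · simp only [quadTrace, zero_mul, add_zero, map_zero, sgn_zero, Finset.sum_const,
        Finset.card_univ, hF]
      exact ⟨2 ^ (n + 3), by simp; ring⟩
    · rw [← Int.pow_dvd_pow_iff two_ne_zero]
      rcases h with h | h | h <;> rw [h]
      · exact dvd_zero _
      · exact ⟨2 ^ (n + 2), by ring⟩
      · exact ⟨2 ^ (n + 4), by ring⟩
  rw [sum_eq_cast_hammingNorm, ZMod.natCast_eq_zero_iff]
  have h := signSum_eq (quadTrace σ a b c)
  rw [hF, pow_add] at h
  rw [signSum] at h
  push_cast at h
  omega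

/-- The words of the extended augmented code. -/
noncomputable def quadWord (e : ℕ) (a b c : F) (h : ZMod 2) : Option Fˣ → ZMod 2 :=
  fun o => quadTrace (frobPow F e) a b c (evalPoint F o) + h

/-- A vanishing quadratic function has exponential sum $q$, and $q^2$ is none of $0,2q,8q$ once
$q\ge32$; its coefficients must be zero. -/
lemma quadWord_injective {m e : ℕ} (hF : Fintype.card F = 2 ^ m) (hm : Odd m) (hm5 : 5 ≤ m)
    (hgcd : Nat.gcd m e = 1) :
    Function.Injective fun p : F × F × F × ZMod 2 => quadWord e p.1 p.2.1 p.2.2.1 p.2.2.2 := by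
  rintro ⟨a, b, c, h⟩ ⟨a', b', c', h'⟩ heq
  have hx : ∀ x, quadTrace (frobPow F e) a b c x + h = quadTrace (frobPow F e) a' b' c' x + h' :=
    fun x => by simpa [quadWord] using congrFun heq ((evalPoint F).symm x)
  have hh : h = h' := by simpa [quadTrace] using hx 0
  subst hh
  have hzero : ∀ x, quadTrace (frobPow F e) (a - a') (b - b') (c - c') x = 0 := fun x => by
    rw [quadTrace_sub, sub_eq_zero]
    exact add_right_cancel (hx x)
  have hpow : (2 : ℤ) ^ m ≥ 2 ^ 5 := pow_le_pow_right₀ (by norm_num) hm5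
  rcases sq_sum_sgn_quadTrace_or _ (frobPow_fixed hF hgcd) hF hm (a - a') (b - b') (c - c')
    with ⟨h1, h2, h3⟩ | h1
  · rw [sub_eq_zero.1 h1, sub_eq_zero.1 h2, sub_eq_zero.1 h3]
  · simp only [hzero, sgn_zero, Finset.sum_const, Finset.card_univ, hF, nsmul_eq_mul, mul_one] at h1
    push_cast at h1
    rcases h1 with h1 | h1 | h1 <;> nlinarith

variable [DecidableEq F]

variable {m e : ℕ} (hF : Fintype.card F = 2 ^ m) (hm : Odd m) (hm5 : 5 ≤ m)
  (hgcd : Nat.gcd m e = 1)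

include hF hm hm5 hgcd

/-- The parity coordinate is the value at $0$: the quadratic part sums to zero over the units, and
the constant `h` is counted $q-1$ times, an odd number. -/
lemma extendWord_add_const (a b c : F) (h : ZMod 2) :
    extendWord ((fun x : Fˣ => quadTrace (frobPow F e) a b c x) + fun _ => h) =
      quadWord e a b c h := by
  have hzero : quadTrace (frobPow F e) a b c 0 = 0 := by simp [quadTrace]
  have hsum : ∑ u : Fˣ, quadTrace (frobPow F e) a b c u = 0 := by
    have h1 := sum_quadTrace (frobPow F e) (frobPow_fixed hF hgcd) hF hm hm5 a b c
    rw [← Equiv.sum_comp (evalPoint F), Fintype.sum_option] at h1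
    simpa [hzero] using h1
  have hcard : (Fintype.card Fˣ : ZMod 2) = 1 := by
    have h1 := card_option_units (F := F)
    rw [Fintype.card_option, hF] at h1
    have h2 := congrArg (Nat.cast : ℕ → ZMod 2) h1
    push_cast at h2
    rw [two_zmod_two, zero_pow (by omega)] at h2
    linear_combination h2 - two_zmod_two
  funext o
  cases o with
  | none =>
    simp only [extendWord, LinearMap.coe_mk, AddHom.coe_mk, Option.elim, quadWord,
      evalPoint_none, hzero, Pi.add_apply, Finset.sum_add_distrib, hsum, Finset.sum_const,
      Finset.card_univ, nsmul_eq_mul, hcard]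
    linear_combination -h * two_zmod_two
  | some u => rfl

lemma mem_codeE {w : Option Fˣ → ZMod 2} :
    w ∈ codeE F e ↔ ∃ a b c h, w = quadWord e a b c h := by
  rw [codeE, extendedCode, Submodule.mem_map]
  constructor
  · rintro ⟨u, hu, rfl⟩
    obtain ⟨v, ⟨a, b, c, rfl⟩, z, hz, rfl⟩ := Submodule.mem_sup.1 hu
    obtain ⟨r, rfl⟩ := Submodule.mem_span_singleton.1 hz
    refine ⟨a, b, c, r, ?_⟩
    rw [← extendWord_add_const hF hm hm5 hgcd]
    congr 1
    funext x
    simp [trace_eq_quadTrace]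
  · rintro ⟨a, b, c, h, rfl⟩
    refine ⟨_, ?_, extendWord_add_const hF hm hm5 hgcd a b c h⟩
    refine Submodule.mem_sup.2 ⟨_, ⟨a, b, c, rfl⟩, _,
      Submodule.mem_span_singleton.2 ⟨h, rfl⟩, ?_⟩
    funext x
    simp [trace_eq_quadTrace]

lemma one_mem_codeE : (fun _ => 1) ∈ codeE F e := by
  rw [mem_codeE hF hm hm5 hgcd]
  exact ⟨0, 0, 0, 1, by funext o; simp [quadWord, quadTrace]⟩

lemma sq_signSum_of_mem_codeE {w : Option Fˣ → ZMod 2} (hw : w ∈ codeE F e) :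
    (w = 0 ∨ w = fun _ => 1) ∨ signSum w ^ 2 = 0 ∨ signSum w ^ 2 = 2 * 2 ^ m ∨
      signSum w ^ 2 = 8 * 2 ^ m := by
  obtain ⟨a, b, c, h, rfl⟩ := (mem_codeE hF hm hm5 hgcd).1 hw
  have hs : signSum (quadWord e a b c h) ^ 2 =
      (∑ x, sgn (quadTrace (frobPow F e) a b c x)) ^ 2 := by
    simp only [signSum, quadWord, sgn_add, ← Finset.sum_mul]
    rw [Equiv.sum_comp (evalPoint F) fun x => sgn (quadTrace (frobPow F e) a b c x), mul_pow,
      sq (sgn h), sgn_mul_self, mul_one]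
  rw [hs]
  refine (sq_sum_sgn_quadTrace_or _ (frobPow_fixed hF hgcd) hF hm a b c).imp_left ?_
  rintro ⟨rfl, rfl, rfl⟩
  by_cases hh : h = 0
  · left; funext o; simp [quadWord, quadTrace, hh]
  · right; funext o; simp [quadWord, quadTrace, zmod_two_eq_one hh]

lemma card_words_codeE : (words (codeE F e)).card = 2 * (2 ^ m) ^ 3 := by
  classical
  have h : words (codeE F e) = Finset.univ.image
      fun p : F × F × F × ZMod 2 => quadWord e p.1 p.2.1 p.2.2.1 p.2.2.2 := by
    ext w
    rw [mem_words, mem_codeE hF hm hm5 hgcd]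
    simp [eq_comm]
  rw [h, Finset.card_image_of_injective _ (quadWord_injective hF hm hm5 hgcd), Finset.card_univ]
  simp only [Fintype.card_prod, hF, ZMod.card]
  ring

/-- The dual code has no words of weight less than six or of odd weight. -/
lemma hammingNorm_of_mem_dualCode {y : Option Fˣ → ZMod 2} (hy : y ∈ dualCode (codeE F e))
    (hy0 : y ≠ 0) : hammingNorm y = 6 ∨ 8 ≤ hammingNorm y := by
  have hmem : ∀ a b c h, ∑ o, quadWord e a b c h o * y o = 0 := fun a b c h =>
    hy _ ((mem_codeE hF hm hm5 hgcd).2 ⟨a, b, c, h, rfl⟩)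
  set D : Finset F := (wordSupport y).map (evalPoint F).toEmbedding with hD
  have hDcard : D.card = hammingNorm y := by rw [hD, Finset.card_map, card_wordSupport]
  have hsum : ∀ f : F → ZMod 2, ∑ o, f (evalPoint F o) * y o = ∑ x ∈ D, f x := by
    intro f
    rw [hD, Finset.sum_map, wordSupport, Finset.sum_filter]
    refine Finset.sum_congr rfl fun o _ => ?_
    split_ifs with ho
    · rw [zmod_two_eq_one ho, mul_one]
      rfl
    · rw [not_not.1 ho, mul_zero]
  have heven : Even (hammingNorm y) := by
    have h1 := hmem 0 0 0 1
    simp only [quadWord, quadTrace, zero_mul, add_zero, map_zero, zero_add, one_mul] at h1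
    rw [sum_eq_cast_hammingNorm, ZMod.natCast_eq_zero_iff] at h1
    exact even_iff_two_dvd.2 h1
  -- Nondegeneracy of the trace form turns orthogonality to all words with parameter `c` (and below,
  -- `b`) into one equation over `F`. The parameter `a` is not used here; it enters only through the
  -- moments, which exclude weight six.
  have hlin : ∑ x ∈ D, x = 0 := by
    by_contra hne
    obtain ⟨c, hc⟩ := exists_trace_mul_ne_zero hne
    refine hc ?_
    rw [Finset.mul_sum, map_sum, ← hsum, ← hmem 0 0 c 0]
    simp [quadWord, quadTrace]
  have hquad : ∑ x ∈ D, x * frobPow F e x = 0 := by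
    by_contra hne
    obtain ⟨b, hb⟩ := exists_trace_mul_ne_zero hne
    refine hb ?_
    rw [Finset.mul_sum, map_sum, ← hsum fun x => Algebra.trace (ZMod 2) F (b * (x * frobPow F e x)),
      ← hmem 0 b 0 0]
    simp [quadWord, quadTrace]
  have hpos := hammingNorm_pos_iff.2 hy0
  have h2 : hammingNorm y ≠ 2 := by
    rw [← hDcard, Ne, Finset.card_eq_two]
    rintro ⟨u, v, huv, hDuv⟩
    rw [hDuv, Finset.sum_pair huv] at hlin
    exact huv (by linear_combination hlin - v * (two_eq_zero_of_algebra (F := F)))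
  have h4 : hammingNorm y ≠ 4 := by
    rw [← hDcard]
    intro h
    obtain ⟨x, D', hx, hDx, hD'⟩ := Finset.card_eq_succ.1 h
    obtain ⟨u, v, w, huv, huw, hvw, hDuvw⟩ := Finset.card_eq_three.1 hD'
    rw [hDuvw] at hx hDx
    simp only [Finset.mem_insert, Finset.mem_singleton, not_or] at hx
    rw [← hDx, Finset.sum_insert (by simpa using hx), Finset.sum_insert (by simp [huv, huw]),
      Finset.sum_pair hvw] at hlin hquad
    rcases eq_or_eq_of_sum_four (frobPow F e) (frobPow_fixed hF hgcd)
      (x := x) (y := u) (z := v) (w := w) (by linear_combination hlin)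
      (by linear_combination hquad) hx.1 with h | h
    · exact hx.2.1 h.symm
    · exact huv h.symm
  obtain ⟨r, hr⟩ := heven
  omega

end CodeE

/-! ### Weight enumeration, minimum weights and designs. -/

section Weights

lemma unitSumCount_two_zero (q : ℤ) : unitSumCount q 2 0 = q := by
  simp [unitSumCount]

lemma unitSumCount_four_zero (q : ℤ) : unitSumCount q 4 0 = 3 * q ^ 2 - 2 * q := by
  norm_num [unitSumCount]; ring

lemma unitSumCount_six_zero (q : ℤ) :
    unitSumCount q 6 0 = 15 * q ^ 3 - 30 * q ^ 2 + 16 * q := by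
  norm_num [unitSumCount]; ring

lemma unitSumCount_eight_zero (q : ℤ) :
    unitSumCount q 8 0 = 105 * q ^ 4 - 420 * q ^ 3 + 588 * q ^ 2 - 272 * q := by
  norm_num [unitSumCount]; ring

lemma unitSumCount_six_six (q : ℤ) : unitSumCount q 6 6 = 720 := by
  norm_num [unitSumCount]

lemma unitSumCount_eight_eight (q : ℤ) : unitSumCount q 8 8 = 40320 := by
  norm_num [unitSumCount]

lemma signSum_add_one {ι : Type*} [Fintype ι] (c : ι → ZMod 2) :
    signSum (c + fun _ => 1) = -signSum c := by
  simp only [signSum, Pi.add_apply, sgn_add, ← Finset.sum_neg_distrib]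
  exact Finset.sum_congr rfl fun i _ => by simp [sgn]

lemma signSum_one {ι : Type*} [Fintype ι] :
    signSum (fun _ : ι => (1 : ZMod 2)) = -Fintype.card ι := by
  simp [signSum, sgn]

lemma signSum_zero {ι : Type*} [Fintype ι] :
    signSum (0 : ι → ZMod 2) = Fintype.card ι := by
  simp [signSum]

/-- The even power moments of a code with three nontrivial values of the squared sign sum. -/
lemma sum_words_signSum_pow_two_mul {ι : Type*} [Fintype ι] [Nonempty ι]
    (C : Submodule (ZMod 2) (ι → ZMod 2)) (h1 : (fun _ => 1) ∈ C) {q A B : ℤ}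
    (hq : (Fintype.card ι : ℤ) = q) (hA0 : A ≠ 0) (hB0 : B ≠ 0) (hAB : A ≠ B) (hAq : A ≠ q ^ 2)
    (hBq : B ≠ q ^ 2)
    (h : ∀ c ∈ C, (c = 0 ∨ c = fun _ => 1) ∨ signSum c ^ 2 = 0 ∨ signSum c ^ 2 = A ∨
      signSum c ^ 2 = B) (j : ℕ) :
    ∑ c ∈ words C, signSum c ^ (2 * j) = 2 * (q ^ 2) ^ j +
      ((words C).filter fun c => signSum c ^ 2 = 0).card * 0 ^ j +
      ((words C).filter fun c => signSum c ^ 2 = A).card * A ^ j +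
      ((words C).filter fun c => signSum c ^ 2 = B).card * B ^ j := by
  classical
  have hq0 : q ^ 2 ≠ 0 := by
    rw [← hq]
    exact pow_ne_zero 2 (by exact_mod_cast Fintype.card_ne_zero)
  have htriv : ∀ c : ι → ZMod 2, (c = 0 ∨ c = fun _ => 1) → signSum c ^ 2 = q ^ 2 := by
    rintro c (rfl | rfl)
    · rw [signSum_zero, hq]
    · rw [signSum_one, hq, neg_sq]
  have hcard : ((words C).filter fun c => c = 0 ∨ c = fun _ => 1).card = 2 := by
    have : ((words C).filter fun c => c = 0 ∨ c = fun _ => 1) = {0, fun _ => 1} := by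
      ext c
      simp only [Finset.mem_filter, mem_words, Finset.mem_insert, Finset.mem_singleton,
        and_iff_right_iff_imp]
      rintro (rfl | rfl)
      · exact C.zero_mem
      · exact h1
    rw [this, Finset.card_pair]
    intro h0
    exact zero_ne_one (congrFun h0 (Classical.arbitrary ι))
  -- The values $q^2,0,A,B$ are distinct, so exactly one indicator is nonzero at each word.
  have key : ∀ c ∈ words C, signSum c ^ (2 * j) =
      (if c = 0 ∨ c = fun _ => 1 then (q ^ 2) ^ j else 0) +
      (if signSum c ^ 2 = 0 then 0 ^ j else 0) + (if signSum c ^ 2 = A then A ^ j else 0) +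
      (if signSum c ^ 2 = B then B ^ j else 0) := by
    intro c hc
    rw [pow_mul]
    by_cases ht : c = 0 ∨ c = fun _ => 1
    · rw [htriv c ht, if_pos ht, if_neg hq0, if_neg hAq.symm, if_neg hBq.symm]
      ring
    · rw [if_neg ht]
      rcases (h c (mem_words.1 hc)).resolve_left ht with h | h | h <;> rw [h]
      · simp [hA0.symm, hB0.symm]
      · simp [hA0, hAB]
      · simp [hB0, hAB.symm]
  rw [Finset.sum_congr rfl key]
  simp only [Finset.sum_add_distrib, ← Finset.sum_filter, Finset.sum_const, nsmul_eq_mul, hcard]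
  push_cast
  ring

/-- Adding the all-one word is an involution of the code that negates the sign sum. -/
lemma card_filter_signSum_neg {ι : Type*} [Fintype ι] (C : Submodule (ZMod 2) (ι → ZMod 2))
    (h1 : (fun _ => 1) ∈ C) (s : ℤ) :
    ((words C).filter fun c => signSum c = -s).card =
      ((words C).filter fun c => signSum c = s).card := by
  have h2 : ∀ c : ι → ZMod 2, (c + fun _ => 1) + (fun _ => 1) = c := fun c => by
    funext i
    simp only [Pi.add_apply, add_assoc, show (1 : ZMod 2) + 1 = 0 from rfl, add_zero]
  refine Finset.card_bij' (fun c _ => c + fun _ => 1) (fun c _ => c + fun _ => 1) ?_ ?_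
    (fun c _ => h2 c) (fun c _ => h2 c)
  all_goals
    intro c hc
    rw [Finset.mem_filter, mem_words] at hc ⊢
    refine ⟨C.add_mem hc.1 h1, ?_⟩
    rw [signSum_add_one, hc.2]
  ring

lemma signSum_eq_of_card {F : Type*} [Field F] [Fintype F] [DecidableEq F] {s : ℕ}
    (hs : Fintype.card F = 2 * s ^ 2) (c : Option Fˣ → ZMod 2) :
    signSum c = 2 * (s : ℤ) ^ 2 - 2 * hammingNorm c := by
  rw [signSum_eq, card_option_units, hs]
  push_cast
  ring

variable {F : Type*} [Field F] [Fintype F] [DecidableEq F] [Algebra (ZMod 2) F]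

/-- The number of words of large sign sum and the numbers of dual words of weights six and
eight. -/
theorem moments_codeE {m e : ℕ} (hF : Fintype.card F = 2 ^ m) (hm : Odd m) (hm5 : 5 ≤ m)
    (hgcd : Nat.gcd m e = 1) {q : ℤ} (hq : q = 2 ^ m) :
    24 * (((words (codeE F e)).filter fun c => signSum c ^ 2 = 8 * 2 ^ m).card : ℤ) =
        q * (q - 1) * (q - 2) ∧
      weightCount (dualCode (codeE F e)) 6 = 0 ∧
      40320 * (weightCount (dualCode (codeE F e)) 8 : ℤ) =
        q * (q - 1) * (q ^ 3 - 12 * q ^ 2 + 156 * q - 272) := by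
  have hq32 : 32 ≤ q := by
    rw [hq]
    exact le_trans (by norm_num) (pow_le_pow_right₀ (by norm_num : (1 : ℤ) ≤ 2) hm5)
  have hcard : (Fintype.card (Option Fˣ) : ℤ) = q := by
    rw [card_option_units, hF, hq]
    norm_num
  have hwords : ((words (codeE F e)).card : ℤ) = 2 * q ^ 3 := by
    rw [card_words_codeE hF hm hm5 hgcd, hq]
    norm_num
  have hsq : ∀ c ∈ codeE F e, (c = 0 ∨ c = fun _ => 1) ∨ signSum c ^ 2 = 0 ∨
      signSum c ^ 2 = 2 * q ∨ signSum c ^ 2 = 8 * q := fun c hc => by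
    rw [hq]
    exact sq_signSum_of_mem_codeE hF hm hm5 hgcd hc
  have hL := sum_words_signSum_pow_two_mul (codeE F e) (one_mem_codeE hF hm hm5 hgcd) hcard
    (A := 2 * q) (B := 8 * q) (by omega) (by omega) (by omega) (by nlinarith) (by nlinarith) hsq
  have hR := fun n => sum_words_signSum_pow_of_le (codeE F e) (n := n)
    fun y hy hy0 => hammingNorm_of_mem_dualCode hF hm hm5 hgcd hy hy0
  rw [← hq]
  simp only [hcard, hwords] at hR
  set N₀ : ℤ := (((words (codeE F e)).filter fun c => signSum c ^ 2 = 0).card : ℤ)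
  set N₁ : ℤ := (((words (codeE F e)).filter fun c => signSum c ^ 2 = 2 * q).card : ℤ)
  set N₂ : ℤ := (((words (codeE F e)).filter fun c => signSum c ^ 2 = 8 * q).card : ℤ)
  set a : ℤ := (weightCount (dualCode (codeE F e)) 6 : ℤ) with ha
  set b : ℤ := (weightCount (dualCode (codeE F e)) 8 : ℤ)
  have e2 := (hL 1).symm.trans (hR 2 (by norm_num))
  have e4 := (hL 2).symm.trans (hR 4 (by norm_num))
  have e6 := (hL 3).symm.trans (hR 6 (by norm_num))
  have e8 := (hL 4).symm.trans (hR 8 (by norm_num))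
  rw [unitSumCount_two_zero, unitSumCount_eq_zero q (by norm_num : 2 < 6),
    unitSumCount_eq_zero q (by norm_num : 2 < 8)] at e2
  rw [unitSumCount_four_zero, unitSumCount_eq_zero q (by norm_num : 4 < 6),
    unitSumCount_eq_zero q (by norm_num : 4 < 8)] at e4
  rw [unitSumCount_six_zero, unitSumCount_six_six,
    unitSumCount_eq_zero q (by norm_num : 6 < 8)] at e6
  rw [unitSumCount_eight_zero, unitSumCount_eight_eight] at e8
  have hq0 : q ≠ 0 := by omega
  -- The 2nd and 4th moments involve no nonzero dual word, so they determine `N₁` and `N₂`; `N₀`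
  -- drops out of all positive moments.
  have f2 : N₁ + 4 * N₂ = q ^ 3 - q := by
    refine mul_left_cancel₀ (mul_ne_zero two_ne_zero hq0) ?_
    linear_combination e2
  have f4 : 2 * (N₁ + 16 * N₂) = 3 * q ^ 3 - 3 * q ^ 2 := by
    refine mul_left_cancel₀ (mul_ne_zero two_ne_zero (pow_ne_zero 2 hq0)) ?_
    linear_combination e4
  have f6 : q ^ 3 + 4 * (N₁ + 64 * N₂) = 15 * q ^ 3 - 30 * q ^ 2 + 16 * q + 720 * a := by
    refine mul_left_cancel₀ (mul_ne_zero two_ne_zero (pow_ne_zero 3 hq0)) ?_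
    linear_combination e6
  have hN₂ : 24 * N₂ = q * (q - 1) * (q - 2) := by
    linear_combination f4 - 2 * f2
  -- With `N₁` and `N₂` known, the 6th moment leaves no room for dual words of weight six.
  have ha0 : a = 0 := by
    have : 720 * a = 0 := by linear_combination -f6 + 4 * f2 + 10 * hN₂
    omega
  refine ⟨hN₂, Int.natCast_eq_zero.1 ha0, ?_⟩
  refine mul_left_cancel₀ (mul_ne_zero two_ne_zero (pow_ne_zero 3 hq0)) ?_
  rw [ha0] at e8
  linear_combination -e8 + 16 * q ^ 4 * f2 + 168 * q ^ 4 * hN₂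

lemma le_hammingNorm_of_mem_dualCode {m e : ℕ} (hF : Fintype.card F = 2 ^ m) (hm : Odd m)
    (hm5 : 5 ≤ m) (hgcd : Nat.gcd m e = 1) {y : Option Fˣ → ZMod 2}
    (hy : y ∈ dualCode (codeE F e)) (hy0 : y ≠ 0) : 8 ≤ hammingNorm y := by
  refine (hammingNorm_of_mem_dualCode hF hm hm5 hgcd hy hy0).resolve_left fun h6 => ?_
  have hA6 := (moments_codeE hF hm hm5 hgcd rfl).2.1
  rw [weightCount, Finset.card_eq_zero] at hA6
  exact Finset.notMem_empty y (hA6 ▸ mem_codewordsOfWeight.2 ⟨hy, h6⟩)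

lemma hammingNorm_mem_of_mem_codeE {m e s : ℕ} (hF : Fintype.card F = 2 ^ m) (hm : Odd m)
    (hm5 : 5 ≤ m) (hgcd : Nat.gcd m e = 1) (hs : Fintype.card F = 2 * s ^ 2)
    {c : Option Fˣ → ZMod 2} (hc : c ∈ codeE F e) :
    c = 0 ∨ c = (fun _ => 1) ∨ hammingNorm c ∈
      ({s ^ 2, s ^ 2 - s, s ^ 2 + s, s ^ 2 - 2 * s, s ^ 2 + 2 * s} : Finset ℕ) := by
  have hq : (2 : ℤ) ^ m = 2 * s ^ 2 := by exact_mod_cast hF.symm.trans hs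
  have h2 : 2 * (2 : ℤ) ^ m = (2 * s) ^ 2 := by rw [hq]; ring
  have h8 : 8 * (2 : ℤ) ^ m = (4 * s) ^ 2 := by rw [hq]; ring
  rw [← or_assoc]
  refine (sq_signSum_of_mem_codeE hF hm hm5 hgcd hc).imp_right fun h => ?_
  rw [h2, h8, sq_eq_sq_iff_eq_or_eq_neg, sq_eq_sq_iff_eq_or_eq_neg, sq_eq_zero_iff,
    signSum_eq_of_card hs, ← Nat.cast_pow] at h
  simp only [Finset.mem_insert, Finset.mem_singleton]
  omega

/-- The words with $S^2=8q=(4s)^2$ split evenly between $S=4s$, which is weight `k`, and $S=-4s$. -/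
lemma weightCount_codeE {m e s k : ℕ} (hF : Fintype.card F = 2 ^ m) (hm : Odd m)
    (hm5 : 5 ≤ m) (hgcd : Nat.gcd m e = 1) (hs : Fintype.card F = 2 * s ^ 2) (hs0 : 0 < s)
    (hk : (k : ℤ) = s ^ 2 - 2 * s) {q : ℤ} (hq : q = 2 ^ m) :
    48 * (weightCount (codeE F e) k : ℤ) = q * (q - 1) * (q - 2) := by
  have hN := (moments_codeE hF hm hm5 hgcd hq).1
  have hqs : (2 : ℤ) ^ m = 2 * s ^ 2 := by exact_mod_cast hF.symm.trans hs
  have hpos : (words (codeE F e)).filter (fun c => signSum c = 4 * (s : ℤ)) =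
      codewordsOfWeight (codeE F e) k := by
    rw [← words_filter_hammingNorm]
    refine Finset.filter_congr fun c _ => ?_
    rw [signSum_eq_of_card hs, ← Nat.cast_inj (R := ℤ), hk]
    constructor <;> intro h <;> linarith
  have hunion : (words (codeE F e)).filter (fun c => signSum c ^ 2 = 8 * 2 ^ m) =
      (words (codeE F e)).filter (fun c => signSum c = 4 * (s : ℤ)) ∪
        (words (codeE F e)).filter (fun c => signSum c = -(4 * (s : ℤ))) := by
    rw [← Finset.filter_or]
    refine Finset.filter_congr fun c _ => ?_
    rw [← sq_eq_sq_iff_eq_or_eq_neg, hqs]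
    constructor <;> intro h <;> linarith
  rw [hunion, Finset.card_union_of_disjoint, card_filter_signSum_neg _
    (one_mem_codeE hF hm hm5 hgcd), hpos, ← weightCount] at hN
  · push_cast at hN
    linarith
  · rw [Finset.disjoint_filter]
    intro c _ h1 h2
    omega

lemma supportsDesigns_codeE {m e : ℕ} (hF : Fintype.card F = 2 ^ m) (hm : Odd m)
    (hm5 : 5 ≤ m) (hgcd : Nat.gcd m e = 1) :
    SupportsDesigns (codeE F e) 3 ∧ SupportsDesigns (dualCode (codeE F e)) 3 := by
  obtain ⟨j, hj⟩ := id hm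
  have hs : Fintype.card F = 2 * (2 ^ j) ^ 2 := by rw [hF, hj]; ring
  have hd := fun y hy hy0 => le_hammingNorm_of_mem_dualCode (y := y) hF hm hm5 hgcd hy hy0
  have hV := fun c hc => hammingNorm_mem_of_mem_codeE (c := c) hF hm hm5 hgcd hs hc
  -- At most five weights plus $t=3$: exactly the dual distance $8$.
  have hcard := Nat.add_le_add_right (Finset.card_le_five (a := (2 ^ j) ^ 2)
    (b := (2 ^ j) ^ 2 - 2 ^ j) (c := (2 ^ j) ^ 2 + 2 ^ j) (d := (2 ^ j) ^ 2 - 2 * 2 ^ j)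
    (e := (2 ^ j) ^ 2 + 2 * 2 ^ j)) 3
  exact ⟨supportsDesigns_of_dual_distance _ hd _ hcard hV,
    supportsDesigns_dualCode_of_dual_distance _ hd _ hcard hV⟩

/-- A code whose words of weight `k` form a `t`-design, `1 ≤ t ≤ k`, supports a simple design. -/
lemma exists_isSimpleDesign {ι : Type*} [Fintype ι] {C : Submodule (ZMod 2) (ι → ZMod 2)}
    {v k : ℕ} (hC : SupportsDesigns C 3) (hv : Fintype.card ι = v) (hk : 3 ≤ k) (hkv : k ≤ v) :
    ∃ lam : ℕ, (lam : ℚ) * (v * (v - 1) * (v - 2)) = weightCount C k * (k * (k - 1) * (k - 2)) ∧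
      IsSimpleDesign 3 v k lam (supportBlocks C k) := by
  subst hv
  obtain ⟨lam, hlam⟩ := hC k hkv
  refine ⟨lam, ?_, by norm_num, hk, hkv, hlam, nodup_supportBlocks _ _⟩
  have h := congrArg (Nat.cast : ℕ → ℚ) hlam.mul_choose
  push_cast at h
  rw [cast_choose_three, cast_choose_three] at h
  linear_combination 6 * h

lemma exists_mem_of_weightCount_pos {ι : Type*} [Fintype ι]
    {C : Submodule (ZMod 2) (ι → ZMod 2)} {k : ℕ} (h : 0 < weightCount C k) (hk : 0 < k) :
    ∃ c ∈ C, c ≠ 0 ∧ hammingNorm c = k := by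
  obtain ⟨c, hc⟩ := Finset.card_pos.1 h
  obtain ⟨hcC, hcw⟩ := mem_codewordsOfWeight.1 hc
  exact ⟨c, hcC, hammingNorm_ne_zero_iff.1 (by omega), hcw⟩

/-- The minimum weight of the extended code and the number of its words. -/
lemma isMinWeight_codeE {m e k : ℕ} (hF : Fintype.card F = 2 ^ m) (hm : Odd m) (hm5 : 5 ≤ m)
    (hgcd : Nat.gcd m e = 1) (hk : k = 2 ^ (m - 1) - 2 ^ ((m + 1) / 2)) :
    3 ≤ k ∧ k ≤ 2 ^ m ∧ IsMinWeight (codeE F e) k ∧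
      48 * (weightCount (codeE F e) k : ℤ) = 2 ^ m * (2 ^ m - 1) * (2 ^ m - 2) := by
  obtain ⟨j, hj⟩ := id hm
  obtain ⟨s, hs⟩ : ∃ s, s = 2 ^ j := ⟨_, rfl⟩
  have hs4 : 4 ≤ s :=
    hs ▸ le_trans (by norm_num) (Nat.pow_le_pow_right (by norm_num : 0 < 2) (by omega : 2 ≤ j))
  have hqs : 2 ^ m = 2 * s ^ 2 := by rw [hj, hs]; ring
  have hks : k = s ^ 2 - 2 * s := by
    rw [hk, show m - 1 = j * 2 by omega, show (m + 1) / 2 = j + 1 by omega, pow_mul, pow_succ 2 j,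
      hs, mul_comm 2 (2 ^ j)]
  have hss : 4 * s ≤ s ^ 2 := by nlinarith
  have hkz : (k : ℤ) = s ^ 2 - 2 * s := by
    rw [hks]
    push_cast [show 2 * s ≤ s ^ 2 by omega]
    ring
  have hA := weightCount_codeE hF hm hm5 hgcd (hF.trans hqs) (by omega) hkz rfl
  have hpow : (32 : ℤ) ≤ 2 ^ m :=
    le_trans (by norm_num) (pow_le_pow_right₀ (by norm_num : (1 : ℤ) ≤ 2) hm5)
  have hpos : 0 < (2 : ℤ) ^ m * (2 ^ m - 1) * (2 ^ m - 2) :=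
    mul_pos (mul_pos (by linarith) (by linarith)) (by linarith)
  refine ⟨by omega, by omega, ⟨exists_mem_of_weightCount_pos (by omega) (by omega), ?_⟩, hA⟩
  rintro _ ⟨c, hc, hc0, rfl⟩
  rcases hammingNorm_mem_of_mem_codeE hF hm hm5 hgcd (hF.trans hqs) hc with h | rfl | h
  · exact absurd h hc0
  · have h1 := signSum_one (ι := Option Fˣ)
    rw [signSum_eq_of_card (hF.trans hqs), card_option_units, hF, hqs] at h1
    push_cast at h1
    zify
    rw [hkz]
    nlinarith
  · simp only [Finset.mem_insert, Finset.mem_singleton] at h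
    omega

/-- The minimum weight of the dual code and the number of its words. -/
lemma isMinWeight_dualCode_codeE {m e : ℕ} (hF : Fintype.card F = 2 ^ m) (hm : Odd m)
    (hm5 : 5 ≤ m) (hgcd : Nat.gcd m e = 1) :
    IsMinWeight (dualCode (codeE F e)) 8 ∧
      (weightCount (dualCode (codeE F e)) 8 : ℚ) =
        1 / 315 * (2 : ℚ) ^ ((m : ℤ) - 7) * ((2 : ℚ) ^ m - 1) *
          (-272 + 39 * (2 : ℚ) ^ (m + 2) - 3 * (4 : ℚ) ^ (m + 1) + (8 : ℚ) ^ m) := by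
  obtain ⟨q, hq⟩ : ∃ q : ℤ, q = 2 ^ m := ⟨_, rfl⟩
  have hA := (moments_codeE hF hm hm5 hgcd hq).2.2
  have hq32 : 32 ≤ q :=
    hq ▸ le_trans (by norm_num) (pow_le_pow_right₀ (by norm_num : (1 : ℤ) ≤ 2) hm5)
  have hpos : 0 < q * (q - 1) * (q ^ 3 - 12 * q ^ 2 + 156 * q - 272) :=
    mul_pos (mul_pos (by linarith) (by linarith)) (by nlinarith)
  refine ⟨⟨exists_mem_of_weightCount_pos (by omega) (by norm_num), ?_⟩, ?_⟩
  · rintro _ ⟨c, hc, hc0, rfl⟩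
    exact le_hammingNorm_of_mem_dualCode hF hm hm5 hgcd hc hc0
  · have hqQ : (q : ℚ) = 2 ^ m := by exact_mod_cast hq
    have hAQ : 40320 * (weightCount (dualCode (codeE F e)) 8 : ℚ) =
        q * (q - 1) * (q ^ 3 - 12 * q ^ 2 + 156 * q - 272) := by
      exact_mod_cast hA
    have h4 : (4 : ℚ) ^ (m + 1) = 4 * q ^ 2 := by
      rw [hqQ, ← pow_mul, mul_comm m 2, pow_mul, pow_succ]
      norm_num
      ring
    have h8 : (8 : ℚ) ^ m = q ^ 3 := by
      rw [hqQ, ← pow_mul, mul_comm m 3, pow_mul]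
      norm_num
    have h7 : (2 : ℚ) ^ ((m : ℤ) - 7) = q / 128 := by
      rw [zpow_sub₀ two_ne_zero, zpow_natCast, hqQ]
      norm_num
    rw [h4, h8, h7, pow_add, ← hqQ]
    linear_combination (1 / 40320 : ℚ) * hAQ

end Weights

theorem mainTheorem1 {F : Type*} [Field F] [Fintype F] [DecidableEq F] [Algebra (ZMod 2) F]
    (m e : ℕ) (hF : Fintype.card F = 2 ^ m) (hm : 5 ≤ m) (he1 : 1 ≤ e) (hem : e ≤ m - 1)
    (he3 : 3 * e ≠ m) (he3' : 3 * e ≠ 2 * m) (hodd : Odd (m / Nat.gcd m e))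
    (hgcd : Nat.gcd m e = 1)
    (q k : ℕ) (hq : q = 2 ^ m) (hk : k = 2 ^ (m - 1) - 2 ^ ((m + 1) / 2)) :
    SupportsDesigns (codeE F e) 3 ∧ SupportsDesigns (dualCode (codeE F e)) 3 ∧
    (IsMinWeight (codeE F e) k ∧
      ∃ lam : ℕ,
        (lam : ℚ) = ((2 : ℚ) ^ (m - 1) - 1) * (k : ℚ) * ((k : ℚ) - 1) * ((k : ℚ) - 2) /
          (24 * ((2 : ℚ) ^ m - 2)) ∧
        IsSimpleDesign 3 q k lam (supportBlocks (codeE F e) k)) ∧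
    (IsMinWeight (dualCode (codeE F e)) 8 ∧
      (weightCount (dualCode (codeE F e)) 8 : ℚ) =
        1 / 315 * (2 : ℚ) ^ ((m : ℤ) - 7) * ((2 : ℚ) ^ m - 1) *
          (-272 + 39 * (2 : ℚ) ^ (m + 2) - 3 * (4 : ℚ) ^ (m + 1) + (8 : ℚ) ^ m) ∧
      ∃ lam : ℕ,
        (lam : ℚ) = 336 * (weightCount (dualCode (codeE F e)) 8 : ℚ) /
          ((q : ℚ) * ((q : ℚ) - 1) * ((q : ℚ) - 2)) ∧
        IsSimpleDesign 3 q 8 lam (supportBlocks (dualCode (codeE F e)) 8)) := by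
  rw [hgcd, Nat.div_one] at hodd
  obtain ⟨hE, hE'⟩ := supportsDesigns_codeE hF hodd hm hgcd
  obtain ⟨hk3, hkq, hmin, hA⟩ := isMinWeight_codeE hF hodd hm hgcd hk
  obtain ⟨hmin', hA'⟩ := isMinWeight_dualCode_codeE hF hodd hm hgcd
  have hcard : Fintype.card (Option Fˣ) = q := by rw [card_option_units, hF, hq]
  have hqQ : (q : ℚ) = 2 ^ m := by exact_mod_cast hq
  have hq32 : (32 : ℚ) ≤ q :=
    hqQ ▸ le_trans (by norm_num) (pow_le_pow_right₀ (by norm_num : (1 : ℚ) ≤ 2) hm)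
  have hAQ : 48 * (weightCount (codeE F e) k : ℚ) = q * (q - 1) * (q - 2) := by
    rw [hqQ]
    exact_mod_cast hA
  have hq0 : (q : ℚ) ≠ 0 := by linarith
  have hq1 : (q : ℚ) - 1 ≠ 0 := by linarith
  have hq2 : (q : ℚ) - 2 ≠ 0 := by linarith
  have hq3 := mul_ne_zero (mul_ne_zero hq0 hq1) hq2
  refine ⟨hE, hE', ⟨hmin, ?_⟩, hmin', hA', ?_⟩
  · obtain ⟨lam, hlam, hdes⟩ := exists_isSimpleDesign hE hcard hk3 (hq ▸ hkq)
    refine ⟨lam, ?_, hdes⟩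
    -- The factor $q(q-1)(q-2)$ of $48A_k$ cancels the one from double counting. The stated form
    -- agrees since $(2^{m-1}-1)/(2^m-2)=1/2$.
    have hlam48 : 48 * (lam : ℚ) = k * (k - 1) * (k - 2) := by
      refine mul_left_cancel₀ hq3 ?_
      linear_combination 48 * hlam + (k * (k - 1) * (k - 2) : ℚ) * hAQ
    have hpow : (2 : ℚ) ^ m = 2 * 2 ^ (m - 1) := by
      rw [← pow_succ']
      congr 1
      omega
    rw [← hqQ] at hpow ⊢
    rw [eq_div_iff (mul_ne_zero (by norm_num) hq2)]
    linear_combination (q - 2 : ℚ) / 2 * hlam48 + (k * (k - 1) * (k - 2) : ℚ) / 2 * hpow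
  · obtain ⟨lam, hlam, hdes⟩ := exists_isSimpleDesign hE' hcard (by norm_num : 3 ≤ 8)
      (by exact_mod_cast (by linarith : (8 : ℚ) ≤ q))
    refine ⟨lam, ?_, hdes⟩
    -- The constant $336$ is $8\cdot7\cdot6$.
    rw [eq_div_iff hq3, hlam]
    push_cast
    ring
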